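/- A two-way deterministic counter automaton (2DCA) is a finite-state machine with a read-only input tape holding $¢\,w\,\$$, a two-way input head that starts on $¢$ and never leaves $¢\,w\,\$$, and an integer counter that is initially $0$. In each step, the state, the scanned symbol, and whether the counter is zero determine the next state, the head move (left, stay or right) and the change of the counter ($-1$, $0$ or $+1$). The computation ends when the accepting or the rejecting state is entered. In a two-way probabilistic counter automaton (2PCA), these data determine instead a probability distribution, with arbitrary real probabilities, on such actions. A 2PCA recognizes a language $L$ with error bound $\varepsilon$, where $0\le\varepsilon<1/2$, if it accepts every $w\in L$ with probability at least $1-\varepsilon$ and every $w\notin L$ with probability at most $\varepsilon$; it recognizes $L$ with bounded error if this holds for some such $\varepsilon$. An automaton runs in linear time if on every input of length $n$ every computation path halts within $O(n+1)$ steps, and in linear space if the absolute value of the counter is $O(n+1)$ on every computation path. Let $$\mathtt{DIMA}=\{\,0^{2^0}10^{2^1}10^{2^2}1\cdots 10^{2^{3k+1}}\,11\,0^{2^{3k+2}}\,11\,0^{2^{3k+3}}1\cdots 10^{2^{6k}} \mid k>0\,\},$$ where the zero-blocks $0^{2^0},\dots,0^{2^{6k}}$ are separated by single $1$s except for the two separators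 $11$ directly before and directly after $0^{2^{3k+2}}$. For $I\subseteq\mathbb{Z}^+$ let $$\mathtt{DIMA}(I)=\{\,w\in\mathtt{DIMA} \mid w\in\{0,1\}^*10^m \text{ for some } m>0 \text{ with } \log_{64}m\in I\,\}.$$ Theorem. (1) Some 2DCA recognizes $\mathtt{DIMA}$ in linear time and linear space. (2) For every $I\subseteq\mathbb{Z}^+$, some 2PCA recognizes $\mathtt{DIMA}(I)$ with error bound $1/4$ in linear time and linear space. (3) The set $\{\mathtt{DIMA}(I)\mid I\subseteq\mathbb{Z}^+\}$ is uncountable. Consequently, (4) the set of languages over $\{0,1\}$ that are recognized with bounded error by 2PCAs in linear time and linear space is uncountable. -/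

import Mathlib

open scoped ENNReal

/-- The symbols of the tape alphabet `Σ ∪ {¢, $}`: the two end-markers and the input letters. -/
inductive TapeSymbol (α : Type) : Type
  | leftEnd : TapeSymbol α
  | letter (a : α) : TapeSymbol α
  | rightEnd : TapeSymbol α

/-- The moves `{←, ↓, →}`, used for the input head and for the counter
(`←` decrements, `↓` keeps, `→` increments). -/
inductive Move : Type
  | left : Move
  | stay : Move
  | right : Move

/-- Effect of a move on the head position. The subtraction at `0` is never used, because
automata do not move to the left of the left end-marker. -/
def Move.onHead : Move → ℕ → ℕ
  | .left, p => p - 1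
  | .stay, p => p
  | .right, p => p + 1

/-- Effect of a move on the counter. -/
def Move.onCounter : Move → ℤ → ℤ
  | .left, v => v - 1
  | .stay, v => v
  | .right, v => v + 1

/-- The symbol in cell `p` of the input tape `¢ w $`: cell `0` holds `¢`, the cells
`1, …, |w|` hold `w`, and cell `|w| + 1` holds `$`. Cells beyond it are never visited. -/
def tapeSymbol {α : Type} (w : List α) : ℕ → TapeSymbol α
  | 0 => .leftEnd
  | p + 1 =>
    match w[p]? with
    | some a => .letter a
    | none => .rightEnd

/-- A configuration: internal state, position of the input head, value of the counter. -/
@[ext]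
structure Config (S : Type) : Type where
  state : S
  head : ℕ
  counter : ℤ

/-- What an automaton does in one step: new state, head move, counter update. -/
abbrev StepAction (S : Type) : Type := S × Move × Move

/-- The configuration that results from an action. -/
def Config.apply {S : Type} (c : Config S) (a : StepAction S) : Config S where
  state := a.1
  head := a.2.1.onHead c.head
  counter := a.2.2.onCounter c.counter

/-- The action does not take the head outside `¢ w $` if `σ` is the scanned symbol. -/
def StaysOnTape {α S : Type} (σ : TapeSymbol α) (a : StepAction S) : Prop :=
  (σ = .leftEnd → a.2.1 ≠ .left) ∧ (σ = .rightEnd → a.2.1 ≠ .right)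

/-- A two-way deterministic counter automaton (2DCA) over the alphabet `α`. The transition
depends on the state, the scanned symbol, and whether the counter is zero. -/
structure TwoDCA (α : Type) : Type 1 where
  State : Type
  finite_state : Finite State
  start : State
  acc : State
  rej : State
  acc_ne_rej : acc ≠ rej
  /-- The Boolean is `true` exactly if the counter is zero. -/
  δ : State → TapeSymbol α → Bool → StepAction State
  stays : ∀ s σ z, StaysOnTape σ (δ s σ z)

/-- A two-way probabilistic counter automaton (2PCA) over the alphabet `α`. The state, the
scanned symbol, and the status of the counter determine a probability distribution, with
arbitrary real probabilities, on the finitely many actions. -/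
structure TwoPCA (α : Type) : Type 1 where
  State : Type
  finite_state : Finite State
  start : State
  acc : State
  rej : State
  acc_ne_rej : acc ≠ rej
  /-- The Boolean is `true` exactly if the counter is zero. -/
  δ : State → TapeSymbol α → Bool → PMF (StepAction State)
  stays : ∀ s σ z, ∀ a ∈ (δ s σ z).support, StaysOnTape σ a

namespace TwoDCA

variable {α : Type} (M : TwoDCA α)

/-- The computation has ended: the accepting or the rejecting state has been entered. -/
def Halted (c : Config M.State) : Prop := c.state = M.acc ∨ c.state = M.rej

open Classical in
/-- One step on input `w`; halted configurations do not change. -/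
noncomputable def step (w : List α) (c : Config M.State) : Config M.State :=
  if M.Halted c then c
  else c.apply (M.δ c.state (tapeSymbol w c.head) (decide (c.counter = 0)))

/-- The configuration after `t` steps on input `w`. -/
noncomputable def run (w : List α) : ℕ → Config M.State
  | 0 => ⟨M.start, 0, 0⟩
  | t + 1 => M.step w (run w t)

/-- The automaton enters its accepting state on input `w`. -/
def Accepts (w : List α) : Prop := ∃ t, (M.run w t).state = M.acc

/-- The language `L` is the set of strings accepted by the automaton. -/
def Recognizes (L : Language α) : Prop := ∀ w, w ∈ L ↔ M.Accepts w

/-- The automaton halts on every input of length `n` within `O(n)` steps. -/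
def LinearTime : Prop :=
  ∃ C : ℕ, ∀ w : List α, M.Halted (M.run w (C * (w.length + 1)))

/-- On every input of length `n`, the absolute value of the counter stays `O(n)`. -/
def LinearSpace : Prop :=
  ∃ C : ℕ, ∀ (w : List α) (t : ℕ), (M.run w t).counter.natAbs ≤ C * (w.length + 1)

end TwoDCA

namespace TwoPCA

variable {α : Type} (M : TwoPCA α)

/-- The computation has ended: the accepting or the rejecting state has been entered. -/
def Halted (c : Config M.State) : Prop := c.state = M.acc ∨ c.state = M.rej

open Classical in
/-- One random step on input `w`; halted configurations do not change. -/
noncomputable def step (w : List α) (c : Config M.State) : PMF (Config M.State) :=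
  if M.Halted c then PMF.pure c
  else (M.δ c.state (tapeSymbol w c.head) (decide (c.counter = 0))).map c.apply

/-- The distribution of the configuration after `t` steps on input `w`. -/
noncomputable def run (w : List α) : ℕ → PMF (Config M.State)
  | 0 => PMF.pure ⟨M.start, 0, 0⟩
  | t + 1 => (run w t).bind (M.step w)

/-- The probability that `w` is accepted. The probability of having accepted after `t` steps
is nondecreasing in `t`, so the supremum is its limit. -/
noncomputable def acceptProb (w : List α) : ℝ≥0∞ :=
  ⨆ t : ℕ, (M.run w t).toOuterMeasure {c | c.state = M.acc}

/-- `L` is recognized with error bound `ε`: every member is accepted with probability at least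
`1 - ε`, and every non-member with probability at most `ε`. -/
def RecognizesWithError (L : Language α) (ε : ℝ≥0∞) : Prop :=
  (∀ w, w ∈ L → 1 - ε ≤ M.acceptProb w) ∧ (∀ w, w ∉ L → M.acceptProb w ≤ ε)

/-- On every input of length `n`, every computation path halts within `O(n)` steps. -/
def LinearTime : Prop :=
  ∃ C : ℕ, ∀ w : List α, ∀ c ∈ (M.run w (C * (w.length + 1))).support, M.Halted c

/-- On every input of length `n`, the absolute value of the counter stays `O(n)` on every
computation path. -/
def LinearSpace : Prop :=
  ∃ C : ℕ, ∀ (w : List α) (t : ℕ), ∀ c ∈ (M.run w t).support,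
    c.counter.natAbs ≤ C * (w.length + 1)

end TwoPCA

/-- The binary languages recognized with bounded error by linear-time and linear-space 2PCAs. -/
def LinearTwoPCALanguages : Set (Language Bool) :=
  {L | ∃ (M : TwoPCA Bool) (ε : ℝ≥0∞), ε < 1 / 2 ∧
    M.RecognizesWithError L ε ∧ M.LinearTime ∧ M.LinearSpace}

/-- The block `0 ^ m`; the letter `0` is `false` and the letter `1` is `true`. -/
def zeros (m : ℕ) : List Bool := List.replicate m false

/-- The separator after the block `0 ^ (2 ^ i)`: it is `11` directly before and directly after
the block `0 ^ (2 ^ (3k+2))`, and `1` everywhere else. -/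
def dimaSep (k i : ℕ) : List Bool :=
  if i = 3 * k + 1 ∨ i = 3 * k + 2 then [true, true] else [true]

/-- The word `0^(2^0) 1 0^(2^1) 1 ⋯ 1 0^(2^(3k+1)) 11 0^(2^(3k+2)) 11 0^(2^(3k+3)) 1 ⋯ 1 0^(2^(6k))`. -/
def dimaWord (k : ℕ) : List Bool :=
  (List.range (6 * k)).flatMap (fun i => zeros (2 ^ i) ++ dimaSep k i) ++ zeros (2 ^ (6 * k))

/-- The language `DIMA`. -/
def DIMA : Language Bool := {w | ∃ k : ℕ, 0 < k ∧ w = dimaWord k}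

/-- The language `DIMA(I)`: the words of `DIMA` of the form `u 1 0 ^ m` with `m > 0` and
`log₆₄ m ∈ I`. -/
def DIMAOf (I : Set ℕ+) : Language Bool :=
  {w | w ∈ DIMA ∧ ∃ (u : List Bool) (m : ℕ), 0 < m ∧ w = u ++ true :: zeros m ∧
    ∃ k ∈ I, m = 64 ^ (k : ℕ)}

/-! Membership in `DIMA` is checked in two deterministic passes. The first loads the counter with
twice the length of a block and compares it with the next block (`reaches_check`); every block is
swept a bounded number of times, so the pass is linear. A word that survives is determined by its
sequence of separators. The second pass checks that sequence: the number of single separators before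
the marked block is tested modulo 3 in the state and compared in the counter with the number after
it (`foldl_scanStep_init`).

For `DIMA(I)`, one real number `p` stores all of `I`: its `k`-th octal digit is `4x + 1`, where `x`
is 1 if `k ∈ I` and 0 otherwise. A coin with bias `p` is tossed once per letter of the last block,
`64 ^ k` times in all. The mean number of heads is `8 ^ k * (8 ^ k * p) = 8 ^ k * (8 * A + 4 * x + 1
+ t)` with `A` natural and `0 ≤ t ≤ 1`, and the standard deviation is at most `8 ^ k / 2`. By
Chebyshev, the number of heads is within `8 ^ k` of its mean with probability at least 3/4
(`le_tossExp_of_near`). The digit leaves a margin of that size on both sides, so the number of heads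
divided by `4 * 8 ^ k` has integer part `2 * A + x` (`blockParity_of_near`). The marked block has
length `2 ^ (3 * k + 2) = 4 * 8 ^ k`; emptying the counter along it and tracking the parity of the
complete sweeps therefore reveals `x` (`run_count`).

The last block of a word determines `k`, so distinct sets `I` give distinct languages, and Cantor's
theorem applies.

Both automata share one transition table. `Reaches` describes stretches where the coin is
irrelevant, `Run` the whole tree of outcomes. -/

/-! ### A two-way counter machine with coin tosses -/

/-- States of the one-way scan over the separators of a word. -/
inductive SepState : Type
  /-- `init i`: exactly `i < 4` separators `1` have been read. -/
  | init (i : Fin 4)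
  /-- `pre j`: `4 + c` separators `1` have been read, where `c ≡ j` modulo `3`. -/
  | pre (j : Fin 3)
  /-- The first separator `11` has been read. -/
  | mid
  /-- Both separators `11` have been read. -/
  | post
  /-- The sequence of separators is not the required one. -/
  | dead
  deriving DecidableEq, Fintype

/-- One step of the scan; the Boolean is `true` for the separator `11`. The move is the update
of the counter. -/
def sepStep : SepState → Bool → SepState × Move
  | .init 0, false => (.init 1, .stay)
  | .init 1, false => (.init 2, .stay)
  | .init 2, false => (.init 3, .stay)
  | .init 3, false => (.pre 0, .stay)
  | .pre 0, false => (.pre 1, .right)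
  | .pre 1, false => (.pre 2, .right)
  | .pre 2, false => (.pre 0, .right)
  | .pre 0, true => (.mid, .stay)
  | .mid, true => (.post, .stay)
  | .post, false => (.post, .left)
  | _, _ => (.dead, .stay)

/-- The states of the machine. -/
inductive DimaState : Type
  | start
  /-- Expects the first block to be `0`. -/
  | first
  /-- Directly after a block, with counter `0`. -/
  | check
  /-- Moves left over a block and adds twice its length to the counter. -/
  | load
  | load'
  /-- Moves right over the block again. -/
  | skip
  | sep
  /-- Compares the next block with the counter. -/
  | dec
  | rewind
  | scan (q : SepState)
  | scanSep (q : SepState)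
  /-- The input is in `DIMA`. -/
  | verified
  /-- Moves left over the last block and counts heads. -/
  | toss
  /-- Searches for a separator `11` to the left. -/
  | find
  | find'
  /-- Decrements the counter while moving left over the marked block. -/
  | count (odd : Bool)
  | back (odd : Bool)
  | acc
  | rej
  deriving DecidableEq, Fintype

namespace DimaState

/-- The transition function of the machine; `z` tells whether the counter is zero, and `b` is
the outcome of a coin toss. -/
def act (s : DimaState) (σ : TapeSymbol Bool) (z b : Bool) : StepAction DimaState :=
  match s with
  | start => match σ with
    | .leftEnd => (first, .right, .stay)
    | _ => (rej, .stay, .stay)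
  | first => match σ with
    | .letter false => (check, .right, .stay)
    | _ => (rej, .stay, .stay)
  | check => match σ with
    | .letter true => (load, .left, .stay)
    | .rightEnd => (rewind, .stay, .stay)
    | _ => (rej, .stay, .stay)
  | load => match σ with
    | .letter false => (load', .stay, .right)
    | .letter true => (skip, .right, .stay)
    | .leftEnd => (skip, .right, .stay)
    | .rightEnd => (rej, .stay, .stay)
  | load' => match σ with
    | .leftEnd => (rej, .stay, .stay)
    | _ => (load, .left, .right)
  | skip => match σ with
    | .letter false => (skip, .right, .stay)
    | .letter true => (sep, .right, .stay)
    | _ => (rej, .stay, .stay)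
  | sep => match σ with
    | .letter true => (dec, .right, .stay)
    | _ => (dec, .stay, .stay)
  | dec => match z with
    | true => (check, .stay, .stay)
    | false => match σ with
      | .letter false => (dec, .right, .left)
      | _ => (rej, .stay, .stay)
  | rewind => match σ with
    | .leftEnd => (scan (.init 0), .right, .stay)
    | _ => (rewind, .left, .stay)
  | scan q => match σ with
    | .letter false => (scan q, .right, .stay)
    | .letter true => (scanSep q, .right, .stay)
    | .rightEnd => match decide (q = .post), z with
      | true, true => (verified, .stay, .stay)
      | _, _ => (rej, .stay, .stay)
    | .leftEnd => (rej, .stay, .stay)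
  | scanSep q => match σ with
    | .letter true => (scan (sepStep q true).1, .right, (sepStep q true).2)
    | .letter false => (scan (sepStep q false).1, .stay, (sepStep q false).2)
    | _ => (rej, .stay, .stay)
  | verified => match σ with
    | .rightEnd => (toss, .left, .stay)
    | _ => (rej, .stay, .stay)
  | toss => match σ with
    | .letter false => (toss, .left, match b with | true => .right | false => .stay)
    | .letter true => (find, .stay, .stay)
    | _ => (rej, .stay, .stay)
  | find => match σ with
    | .letter false => (find, .left, .stay)
    | .letter true => (find', .left, .stay)
    | _ => (rej, .stay, .stay)
  | find' => match σ with
    | .letter false => (find, .stay, .stay)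
    | .letter true => (count false, .left, .stay)
    | _ => (rej, .stay, .stay)
  | count odd => match σ with
    | .letter false => match z with
      | true => (match odd with | true => acc | false => rej, .stay, .stay)
      | false => (count odd, .left, .left)
    | .letter true => (back (!odd), .right, .stay)
    | _ => (rej, .stay, .stay)
  | back odd => match σ with
    | .letter false => (back odd, .right, .stay)
    | .letter true => (count odd, .left, .stay)
    | _ => (rej, .stay, .stay)
  -- A dummy value: `tosser` halts in `acc`, and `verifier` halts in `verified`, through which every
  -- path to `acc` leads.
  | acc => (rej, .stay, .stay)
  | rej => (rej, .stay, .stay)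

theorem staysOnTape_act (s : DimaState) (σ : TapeSymbol Bool) (z b : Bool) :
    StaysOnTape σ (s.act σ z b) := by
  cases s <;> rcases σ with _ | (_ | _) | _ <;> cases z <;> cases b <;>
    simp [StaysOnTape, act] <;> split <;> simp

/-- The states in which no machine built from `act` halts. -/
def working : DimaState → Bool
  | verified => false
  | acc => false
  | rej => false
  | _ => true

/-- The successor of a configuration if the coin shows `b`. -/
def next (w : List Bool) (b : Bool) (c : Config DimaState) : Config DimaState :=
  c.apply (c.state.act (tapeSymbol w c.head) (decide (c.counter = 0)) b)

/-- The machine gets from `c` to `c'` in at most `t` steps, whatever the coin shows, with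
counter values at most `K` on the way. -/
inductive Reaches (w : List Bool) (K : ℕ) : ℕ → Config DimaState → Config DimaState → Prop
  | refl (t : ℕ) (c : Config DimaState) : Reaches w K t c c
  | step {t : ℕ} {c c' : Config DimaState} (c₁ : Config DimaState) :
      c.state.working = true → c.counter.natAbs ≤ K → (∀ b, next w b c = c₁) →
      Reaches w K t c₁ c' → Reaches w K (t + 1) c c'

/-- From `c`, if the machine tosses heads with probability `p`, stops in the states `A` and
`rej` and accepts in `A`, then it accepts with probability `q`, and all its paths halt within
`t` steps with counter values at most `K`. -/
inductive Run (A : DimaState) (w : List Bool) (p : ℝ) (K : ℕ) :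
    ℕ → Config DimaState → ℝ → Prop
  | acc (t : ℕ) {c : Config DimaState} : c.state = A → c.counter.natAbs ≤ K → Run A w p K t c 1
  | rej (t : ℕ) {c : Config DimaState} :
      c.state = rej → c.counter.natAbs ≤ K → Run A w p K t c 0
  | step {t : ℕ} {c : Config DimaState} {q₁ q₀ : ℝ} :
      c.state ≠ A → c.state ≠ DimaState.rej → c.counter.natAbs ≤ K →
      Run A w p K t (next w true c) q₁ → Run A w p K t (next w false c) q₀ →
      Run A w p K (t + 1) c (p * q₁ + (1 - p) * q₀)

variable {A : DimaState} {w : List Bool} {p : ℝ} {K t t' : ℕ} {c c' c'' : Config DimaState}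
  {q : ℝ}

theorem Reaches.mono (h : Reaches w K t c c') (htt : t ≤ t') : Reaches w K t' c c' := by
  induction h generalizing t' with
  | refl => exact .refl _ _
  | step c₁ h1 h2 h3 _ ih =>
    obtain ⟨t', rfl⟩ := Nat.exists_eq_add_of_lt (Nat.lt_of_succ_le htt)
    exact .step c₁ h1 h2 h3 (ih (by omega))

theorem Reaches.trans (h : Reaches w K t c c') (h' : Reaches w K t' c' c'') :
    Reaches w K (t + t') c c'' := by
  induction h with
  | refl => exact h'.mono (by omega)
  | step c₁ h1 h2 h3 _ ih => exact (Reaches.step c₁ h1 h2 h3 (ih h')).mono (by omega)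

theorem Reaches.cons {s : DimaState} {x : ℕ} {v : ℤ} {σ : TapeSymbol Bool}
    (hσ : tapeSymbol w x = σ) (hs : s.working = true) (hv : v.natAbs ≤ K)
    (a : StepAction DimaState) (ha : ∀ b, act s σ (decide (v = 0)) b = a)
    (h : Reaches w K t ⟨a.1, a.2.1.onHead x, a.2.2.onCounter v⟩ c') :
    Reaches w K (t + 1) ⟨s, x, v⟩ c' :=
  .step _ hs hv (fun b => by simp only [DimaState.next, hσ, ha b, Config.apply]) h

theorem Run.mono (h : Run A w p K t c q) (htt : t ≤ t') : Run A w p K t' c q := by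
  induction h generalizing t' with
  | acc _ h1 h2 => exact .acc _ h1 h2
  | rej _ h1 h2 => exact .rej _ h1 h2
  | step h1 h2 h3 _ _ ih1 ih0 =>
    obtain ⟨t', rfl⟩ := Nat.exists_eq_add_of_lt (Nat.lt_of_succ_le htt)
    exact .step h1 h2 h3 (ih1 (by omega)) (ih0 (by omega))

theorem Run.cons {s : DimaState} {x : ℕ} {v : ℤ} {σ : TapeSymbol Bool}
    (hσ : tapeSymbol w x = σ) (hA : s ≠ A) (hs : s ≠ DimaState.rej) (hv : v.natAbs ≤ K)
    (a : StepAction DimaState) (ha : ∀ b, act s σ (decide (v = 0)) b = a)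
    (h : Run A w p K t ⟨a.1, a.2.1.onHead x, a.2.2.onCounter v⟩ q) :
    Run A w p K (t + 1) ⟨s, x, v⟩ q := by
  have h' : ∀ b, Run A w p K t (DimaState.next w b ⟨s, x, v⟩) q := fun b => by
    simpa only [DimaState.next, hσ, ha b, Config.apply] using h
  have := Run.step (c := ⟨s, x, v⟩) hA hs hv (h' true) (h' false)
  rwa [← add_mul, add_sub_cancel, one_mul] at this

/-- Both outcomes of a toss lead to the same successor, so the weights `p` and `1 - p` add up to 1.
The condition on `A` ensures that the deterministic stretch does not pass through the accepting
state. -/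
theorem Reaches.run (h : Reaches w K t c c') (hA : A.working = false)
    (h' : Run A w p K t' c' q) : Run A w p K (t + t') c q := by
  induction h with
  | refl => exact h'.mono (by omega)
  | @step t c c' c₁ h1 h2 h3 _ ih =>
    have := ih h'
    have := Run.step (c := c) (fun e => by rw [e, hA] at h1; cases h1)
      (fun e => by rw [e] at h1; cases h1)
      h2 (by rwa [h3]) (by rwa [h3])
    rw [← add_mul, add_sub_cancel, one_mul] at this
    exact this.mono (by omega)

theorem Run.prob_mem (h : Run A w p K t c q) (h0 : 0 ≤ p) (h1 : p ≤ 1) : 0 ≤ q ∧ q ≤ 1 := by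
  induction h with
  | acc => simp
  | rej => simp
  | step _ _ _ _ _ ih1 ih0 => constructor <;> nlinarith

/-- The deterministic automaton that checks membership in `DIMA`. -/
abbrev verifier : TwoDCA Bool where
  State := DimaState
  finite_state := inferInstance
  start := start
  acc := verified
  rej := rej
  acc_ne_rej := by decide
  δ s σ z := s.act σ z false
  stays s σ z := s.staysOnTape_act σ z false

/-- A coin that shows heads with probability `p`. -/
noncomputable def coin (p : ℝ) (h0 : 0 ≤ p) (h1 : p ≤ 1) : PMF Bool :=
  PMF.ofFintype (fun b => ENNReal.ofReal (cond b p (1 - p))) (by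
    simp [← ENNReal.ofReal_add h0 (sub_nonneg.2 h1)])

/-- The probabilistic automaton that checks membership in `DIMA` and then evaluates a bit of
the number of heads. -/
noncomputable abbrev tosser (p : ℝ) (h0 : 0 ≤ p) (h1 : p ≤ 1) : TwoPCA Bool where
  State := DimaState
  finite_state := inferInstance
  start := start
  acc := acc
  rej := rej
  acc_ne_rej := by decide
  δ s σ z := (coin p h0 h1).map (s.act σ z)
  stays s σ z a ha := by
    obtain ⟨b, -, rfl⟩ := (PMF.mem_support_map_iff _ _ _).1 ha
    exact s.staysOnTape_act σ z b

end DimaState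

/-! ### Runs of the two automata -/

/-- The configuration of a 2DCA after `t` steps from `c`. -/
noncomputable def TwoDCA.evolve {α : Type} (M : TwoDCA α) (w : List α) (t : ℕ)
    (c : Config M.State) : Config M.State := (M.step w)^[t] c

theorem TwoDCA.run_eq_evolve {α : Type} (M : TwoDCA α) (w : List α) (t : ℕ) :
    M.run w t = M.evolve w t ⟨M.start, 0, 0⟩ := by
  induction t with
  | zero => rfl
  | succ t ih => rw [TwoDCA.run, ih, TwoDCA.evolve, TwoDCA.evolve, Function.iterate_succ_apply']

theorem TwoDCA.step_of_not_halted {α : Type} (M : TwoDCA α) (w : List α) {c : Config M.State}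
    (hc : ¬ M.Halted c) :
    M.step w c = c.apply (M.δ c.state (tapeSymbol w c.head) (decide (c.counter = 0))) := by
  rw [TwoDCA.step, if_neg hc]

theorem TwoDCA.evolve_of_halted {α : Type} (M : TwoDCA α) (w : List α) (t : ℕ)
    {c : Config M.State} (hc : M.Halted c) : M.evolve w t c = c :=
  Function.iterate_fixed (by simp [TwoDCA.step, hc]) t

/-- The distribution of the configuration of a 2PCA after `t` steps from `c`. -/
noncomputable def TwoPCA.evolve {α : Type} (M : TwoPCA α) (w : List α) :
    ℕ → Config M.State → PMF (Config M.State)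
  | 0, c => PMF.pure c
  | t + 1, c => (M.step w c).bind (TwoPCA.evolve M w t)

/-- `run` appends the last step whereas `evolve`, like `Run`, splits off the first; associativity of
`bind` reconciles the two. -/
theorem TwoPCA.evolve_succ' {α : Type} (M : TwoPCA α) (w : List α) (t : ℕ)
    (c : Config M.State) : M.evolve w (t + 1) c = (M.evolve w t c).bind (M.step w) := by
  induction t generalizing c with
  | zero => simp [TwoPCA.evolve]
  | succ t ih =>
    rw [TwoPCA.evolve, TwoPCA.evolve, PMF.bind_bind]
    exact congrArg _ (funext ih)

theorem TwoPCA.run_eq_evolve {α : Type} (M : TwoPCA α) (w : List α) (t : ℕ) :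
    M.run w t = M.evolve w t ⟨M.start, 0, 0⟩ := by
  induction t with
  | zero => rfl
  | succ t ih => rw [TwoPCA.run, ih, TwoPCA.evolve_succ']

theorem TwoPCA.step_of_not_halted {α : Type} (M : TwoPCA α) (w : List α) {c : Config M.State}
    (hc : ¬ M.Halted c) :
    M.step w c =
      (M.δ c.state (tapeSymbol w c.head) (decide (c.counter = 0))).map c.apply := by
  rw [TwoPCA.step, if_neg hc]

theorem TwoPCA.evolve_of_halted {α : Type} (M : TwoPCA α) (w : List α) (t : ℕ)
    {c : Config M.State} (hc : M.Halted c) : M.evolve w t c = PMF.pure c := by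
  induction t with
  | zero => rfl
  | succ t ih => rw [TwoPCA.evolve, TwoPCA.step, if_pos hc, PMF.pure_bind, ih]

namespace DimaState

variable {A : DimaState} {w : List Bool} {p : ℝ} {K t : ℕ} {c : Config DimaState} {q : ℝ}

theorem verifier_step (hA : c.state ≠ verified) (hR : c.state ≠ rej) :
    verifier.step w c = next w false c := by
  have : ¬ verifier.Halted c := by rintro (h | h); exacts [hA h, hR h]
  exact verifier.step_of_not_halted w this

/-- At `p = 0` all weight lies on the branch of tails, which is the branch that `verifier` follows;
hence the value is 0 or 1 according to the actual computation. -/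
theorem verifier_evolve_of_run (h : Run verified w 0 K t c q) :
    verifier.Halted (verifier.evolve w t c) ∧
    (∀ u, (verifier.evolve w u c).counter.natAbs ≤ K) ∧
    (q = 1 ∧ (∃ u, (verifier.evolve w u c).state = verified) ∨
      q = 0 ∧ ∀ u, (verifier.evolve w u c).state ≠ verified) := by
  induction h with
  | acc t h1 h2 =>
    have hc := fun u => verifier.evolve_of_halted w u (Or.inl h1)
    simp only [hc]
    exact ⟨Or.inl h1, fun _ => h2, Or.inl ⟨trivial, 0, h1⟩⟩
  | rej t h1 h2 =>
    have hc := fun u => verifier.evolve_of_halted w u (Or.inr h1)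
    simp only [hc]
    exact ⟨Or.inr h1, fun _ => h2, Or.inr ⟨trivial, fun _ => by rw [h1]; exact DimaState.noConfusion⟩⟩
  | @step t c q₁ q₀ h1 h2 h3 _ _ _ ih =>
    have hs : ∀ u, verifier.evolve w (u + 1) c = verifier.evolve w u (next w false c) := by
      intro u
      exact (Function.iterate_succ_apply _ _ _).trans (congrArg _ (verifier_step h1 h2))
    obtain ⟨i1, i2, i3⟩ := ih
    refine ⟨by rw [hs]; exact i1, ?_, ?_⟩
    · rintro (_ | u)
      · exact h3
      · rw [hs]; exact i2 u
    · refine i3.imp ?_ ?_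
      · rintro ⟨rfl, u, hu⟩
        exact ⟨by ring, u + 1, by rw [hs]; exact hu⟩
      · rintro ⟨rfl, hu⟩
        refine ⟨by ring, ?_⟩
        rintro (_ | u)
        · exact h1
        · rw [hs]; exact hu u

variable {h0 : 0 ≤ p} {h1 : p ≤ 1}

theorem tosser_step (hA : c.state ≠ acc) (hR : c.state ≠ rej) :
    (tosser p h0 h1).step w c = (coin p h0 h1).map (fun b => next w b c) := by
  have : ¬ (tosser p h0 h1).Halted c := by rintro (h | h); exacts [hA h, hR h]
  exact ((tosser p h0 h1).step_of_not_halted w this).trans (PMF.map_comp _ _ _)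

/-- By the law of total probability for the first toss. The upper bound at all times and the
equality at time `t` together identify the supremum in `acceptProb`. -/
theorem tosser_evolve_of_run (h : Run acc w p K t c q) :
    (∀ c' ∈ ((tosser p h0 h1).evolve w t c).support, (tosser p h0 h1).Halted c') ∧
    (∀ u, ∀ c' ∈ ((tosser p h0 h1).evolve w u c).support, c'.counter.natAbs ≤ K) ∧
    (∀ u, ((tosser p h0 h1).evolve w u c).toOuterMeasure {c | c.state = acc}
      ≤ ENNReal.ofReal q) ∧
    ((tosser p h0 h1).evolve w t c).toOuterMeasure {c | c.state = acc} = ENNReal.ofReal q := by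
  classical
  induction h with
  | @acc t c e h2 =>
    have hc := fun u => (tosser p h0 h1).evolve_of_halted w u (c := c) (Or.inl e)
    have hm : (PMF.pure c).toOuterMeasure {c | c.state = acc} = 1 := by
      rw [PMF.toOuterMeasure_pure_apply, if_pos (by exact e)]
    simp only [hc, hm]
    simp [e, h2, TwoPCA.Halted]
  | @rej t c e h2 =>
    have hc := fun u => (tosser p h0 h1).evolve_of_halted w u (c := c) (Or.inr e)
    have hm : (PMF.pure c).toOuterMeasure {c | c.state = acc} = 0 := by
      rw [PMF.toOuterMeasure_pure_apply, if_neg (by simp [e])]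
    simp only [hc, hm]
    simp [e, h2, TwoPCA.Halted]
  | @step t c q₁ q₀ hA hR h3 r1 r0 ih1 ih0 =>
    have hs : ∀ u, (tosser p h0 h1).evolve w (u + 1) c =
        (coin p h0 h1).bind (fun b => (tosser p h0 h1).evolve w u (next w b c)) := by
      intro u
      exact (congrArg (PMF.bind · _) (tosser_step hA hR)).trans (PMF.bind_map _ _ _)
    have hm : ∀ u S, ((tosser p h0 h1).evolve w (u + 1) c).toOuterMeasure S =
        ENNReal.ofReal p * ((tosser p h0 h1).evolve w u (next w true c)).toOuterMeasure S +
        ENNReal.ofReal (1 - p) *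
          ((tosser p h0 h1).evolve w u (next w false c)).toOuterMeasure S := by
      intro u S
      rw [hs, PMF.toOuterMeasure_bind_apply, tsum_bool, add_comm]
      simp [coin]
    have hq : ENNReal.ofReal (p * q₁ + (1 - p) * q₀) =
        ENNReal.ofReal p * ENNReal.ofReal q₁ + ENNReal.ofReal (1 - p) * ENNReal.ofReal q₀ := by
      have := r1.prob_mem h0 h1
      have := r0.prob_mem h0 h1
      have h1' := sub_nonneg.2 h1
      rw [ENNReal.ofReal_add (by nlinarith) (by nlinarith), ENNReal.ofReal_mul h0,
        ENNReal.ofReal_mul h1']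
    obtain ⟨a1, a2, a3, a4⟩ := ih1
    obtain ⟨b1, b2, b3, b4⟩ := ih0
    refine ⟨?_, ?_, ?_, ?_⟩
    · intro c' hc'
      rw [hs, PMF.mem_support_bind_iff] at hc'
      obtain ⟨_ | _, -, hc'⟩ := hc'
      exacts [b1 _ hc', a1 _ hc']
    · rintro (_ | u) c' hc'
      · rw [(PMF.mem_support_pure_iff _ _).1 hc']; exact h3
      · rw [hs, PMF.mem_support_bind_iff] at hc'
        obtain ⟨_ | _, -, hc'⟩ := hc'
        exacts [b2 _ _ hc', a2 _ _ hc']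
    · rintro (_ | u)
      · refine ((PMF.toOuterMeasure_pure_apply _ _).trans (if_neg ?_)).trans_le zero_le
        exact hA
      · rw [hm, hq]
        gcongr
        exacts [a3 u, b3 u]
    · rw [hm, hq, a4, b4]

end DimaState

/-! ### The tape -/

theorem tapeSymbol_succ (w : List Bool) (i : ℕ) :
    tapeSymbol w (i + 1) = w[i]?.elim .rightEnd .letter := by
  rw [tapeSymbol]
  cases w[i]? <;> rfl

theorem tapeSymbol_append {u v : List Bool} (i : ℕ) :
    tapeSymbol (u ++ v) (u.length + i + 1) = tapeSymbol v (i + 1) := by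
  rw [tapeSymbol_succ, tapeSymbol_succ, List.getElem?_append_right (by omega),
    Nat.add_sub_cancel_left]

theorem tapeSymbol_of_eq_append_cons {w u r : List Bool} {b : Bool} {x : ℕ}
    (hw : w = u ++ b :: r) (hx : x = u.length + 1) : tapeSymbol w x = .letter b := by
  subst hw hx
  exact tapeSymbol_append 0

theorem tapeSymbol_of_eq_append_zeros {w u r : List Bool} {a x : ℕ}
    (hw : w = u ++ (zeros a ++ r)) (hx : x = u.length + 1) :
    ∀ i < a, tapeSymbol w (x + i) = .letter false := by
  subst hw hx
  intro i hi
  rw [add_right_comm, tapeSymbol_append]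
  simp [tapeSymbol_succ, zeros, List.getElem?_append_left, hi]

theorem tapeSymbol_length_add_one {w : List Bool} {x : ℕ} (hx : x = w.length + 1) :
    tapeSymbol w x = .rightEnd := by
  subst hx
  simp [tapeSymbol_succ]

theorem tapeSymbol_ne_leftEnd (w : List Bool) (x : ℕ) : tapeSymbol w (x + 1) ≠ .leftEnd := by
  rw [tapeSymbol]
  split <;> simp

/-! ### Words with doubling blocks -/

/-- The separator `11` or `1`. -/
def sepWord (s : Bool) : List Bool := if s then [true, true] else [true]

/-- What follows a block of length `a` in a word in which the length of each block is twice that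
of the previous one and the separators are given by `ss`. -/
def tailWord : ℕ → List Bool → List Bool
  | _, [] => []
  | a, s :: ss => sepWord s ++ (zeros (2 * a) ++ tailWord (2 * a) ss)

@[simp] theorem length_zeros (a : ℕ) : (zeros a).length = a := List.length_replicate

theorem zeros_succ (a : ℕ) : zeros (a + 1) = false :: zeros a := rfl

theorem tailWord_ne_false_cons (a : ℕ) (ss r : List Bool) : tailWord a ss ≠ false :: r := by
  rcases ss with _ | ⟨_ | _, ss⟩ <;> simp [tailWord, sepWord]

theorem length_le_length_tailWord (a : ℕ) (ss : List Bool) :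
    ss.length ≤ (tailWord a ss).length := by
  induction ss generalizing a with
  | nil => simp [tailWord]
  | cons s ss ih =>
    have := ih (2 * a)
    cases s <;> simp [tailWord, sepWord] <;> omega

theorem tailWord_append (a : ℕ) (s₁ s₂ : List Bool) :
    tailWord a (s₁ ++ s₂) = tailWord a s₁ ++ tailWord (2 ^ s₁.length * a) s₂ := by
  induction s₁ generalizing a with
  | nil => simp [tailWord]
  | cons s ss ih => simp [tailWord, ih, pow_succ, mul_assoc]

/-! ### Checking that each block is twice as long as the previous one -/

namespace DimaState

variable {w u r : List Bool} {K a x t n : ℕ} {v : ℤ} {s : DimaState} {c c' : Config DimaState}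

theorem reaches_right (hs : s.working = true)
    (ha : ∀ z b, act s (.letter false) z b = (s, .right, .stay))
    (hz : ∀ i < a, tapeSymbol w (x + i) = .letter false) (hv : v.natAbs ≤ K) :
    Reaches w K a ⟨s, x, v⟩ ⟨s, x + a, v⟩ := by
  induction a generalizing x with
  | zero => exact .refl _ _
  | succ a ih =>
    refine .cons (hz 0 (by omega)) hs hv _ (fun b => ha _ b) ?_
    have := ih (x := x + 1) (fun i hi => by rw [add_assoc, add_comm 1]; exact hz _ (by omega))
    rwa [add_assoc, add_comm 1] at this

theorem reaches_left (hs : s.working = true)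
    (ha : ∀ z b, act s (.letter false) z b = (s, .left, .stay))
    (hz : ∀ i < a, tapeSymbol w (x + 1 + i) = .letter false) (hv : v.natAbs ≤ K) :
    Reaches w K a ⟨s, x + a, v⟩ ⟨s, x, v⟩ := by
  induction a with
  | zero => exact .refl _ _
  | succ a ih =>
    refine .cons (σ := .letter false) ?_ hs hv _ (fun b => ha _ b) ?_
    · rw [← hz a (by omega)]; congr 1; omega
    · exact ih fun i hi => hz i (by omega)

theorem reaches_load (hz : ∀ i < a, tapeSymbol w (x + 1 + i) = .letter false)
    (hv : v.natAbs + 2 * a ≤ K) :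
    Reaches w K (2 * a) ⟨load, x + a, v⟩ ⟨load, x, v + 2 * a⟩ := by
  induction a generalizing v with
  | zero => simpa using Reaches.refl _ _
  | succ a ih =>
    have h0 : tapeSymbol w (x + (a + 1)) = .letter false := by
      rw [← hz a (by omega)]; congr 1; omega
    refine .cons h0 rfl (by omega) _ (fun b => rfl) ?_
    refine .cons h0 rfl (by simp [Move.onCounter]; omega) _ (fun b => rfl) ?_
    have := ih (v := v + 1 + 1) (fun i hi => hz i (by omega)) (by omega)
    rw [show v + 2 * ((a + 1 : ℕ) : ℤ) = v + 1 + 1 + 2 * a by push_cast; ring]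
    exact this

/-- The configuration leads to rejection within `t` steps. -/
def Fails (w : List Bool) (K t : ℕ) (c : Config DimaState) : Prop :=
  ∃ x v, v.natAbs ≤ K ∧ Reaches w K t c ⟨rej, x, v⟩

theorem Reaches.fails {t' : ℕ} (h : Reaches w K t c c') (h' : Fails w K t' c') :
    Fails w K (t + t') c := by
  obtain ⟨x, v, hv, h'⟩ := h'
  exact ⟨x, v, hv, h.trans h'⟩

theorem Fails.mono {t' : ℕ} (h : Fails w K t c) (htt : t ≤ t') : Fails w K t' c := by
  obtain ⟨x, v, hv, h⟩ := h
  exact ⟨x, v, hv, h.mono htt⟩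

theorem fails_of_act {σ : TapeSymbol Bool} (hσ : tapeSymbol w x = σ) (hs : s.working = true)
    (hv : v.natAbs ≤ K) (ha : ∀ b, act s σ (decide (v = 0)) b = (rej, .stay, .stay)) :
    Fails w K 1 ⟨s, x, v⟩ :=
  ⟨x, v, hv, .cons hσ hs hv _ ha (.refl _ _)⟩

theorem tapeSymbol_of_eq_append (hw : w = u ++ r) (hx : x = u.length + 1)
    (hr : ∀ r', r ≠ false :: r') :
    r = [] ∧ tapeSymbol w x = .rightEnd ∨ ∃ r', r = true :: r' ∧ tapeSymbol w x = .letter true := by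
  rcases r with _ | ⟨_ | _, r⟩
  · exact .inl ⟨rfl, tapeSymbol_length_add_one (by simp [hw, hx])⟩
  · exact absurd rfl (hr r)
  · exact .inr ⟨r, rfl, tapeSymbol_of_eq_append_cons hw hx⟩

/-- The counter is tested before the tape is read, so exactly `n` zeros are consumed. A longer block
is not noticed here; `check` rejects it when it meets the next 0. -/
theorem reaches_dec (hw : w = u ++ r) (hx : x = u.length + 1) (hK : n ≤ K) :
    (∃ r', r = zeros n ++ r' ∧ Reaches w K (n + 1) ⟨dec, x, n⟩ ⟨check, x + n, 0⟩) ∨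
      (∀ r', r ≠ zeros n ++ r') ∧ Fails w K (n + 1) ⟨dec, x, n⟩ := by
  induction n generalizing u r x with
  | zero =>
    exact .inl ⟨r, rfl, .cons rfl rfl (by simp) (check, .stay, .stay) (fun b => rfl) (.refl _ _)⟩
  | succ n ih =>
    have hd : decide (((n + 1 : ℕ) : ℤ) = 0) = false := by simp; omega
    by_cases hr : ∃ r', r = false :: r'
    · obtain ⟨r, rfl⟩ := hr
      have h0 : Reaches w K 1 ⟨dec, x, (n + 1 : ℕ)⟩ ⟨dec, x + 1, n⟩ := by
        refine .cons (tapeSymbol_of_eq_append_cons hw hx) rfl (by omega) (dec, .right, .left)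
          (fun b => by rw [hd]; rfl) ?_
        simpa [Move.onHead, Move.onCounter] using Reaches.refl _ _
      rcases ih (u := u ++ [false]) (r := r) (x := x + 1) (by simp [hw]) (by simp [hx])
        (by omega) with ⟨r', rfl, h⟩ | ⟨hr, h⟩
      · refine .inl ⟨r', rfl, ?_⟩
        rw [add_assoc, add_comm 1] at h
        exact (h0.trans h).mono (by omega)
      · refine .inr ⟨fun r' e => hr r' (by simpa [zeros_succ] using e), (h0.fails h).mono (by omega)⟩
    · push Not at hr
      refine .inr ⟨fun r' => hr (zeros n ++ r'), ?_⟩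
      rcases tapeSymbol_of_eq_append hw hx hr with ⟨-, h⟩ | ⟨_, -, h⟩ <;>
        exact (fails_of_act h rfl (by omega) (fun b => by rw [hd]; rfl)).mono (by omega)

/-- The left sweep needs a stop to the left of the block: the end-marker if `u` is empty, otherwise
the last 1 of the preceding separator. -/
theorem reaches_load_skip (hw : w = u ++ (zeros a ++ true :: r)) (hu : u = [] ∨ ∃ u', u = u' ++ [true])
    (hx : x = u.length + 1) (ha : 1 ≤ a) (hK : 2 * a ≤ K) :
    Reaches w K (3 * a + 3) ⟨check, x + a, 0⟩ ⟨sep, x + a + 1, 2 * a⟩ := by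
  obtain ⟨y, rfl⟩ : ∃ y, x = y + 1 := ⟨_, hx⟩
  have hz := tapeSymbol_of_eq_append_zeros hw hx
  have h1 : tapeSymbol w (y + 1 + a) = .letter true :=
    tapeSymbol_of_eq_append_cons (u := u ++ zeros a) (r := r) (by simp [hw]) (by simp; omega)
  have hy : tapeSymbol w y = .leftEnd ∨ tapeSymbol w y = .letter true := by
    rcases hu with rfl | ⟨u', rfl⟩
    · obtain rfl : y = 0 := by simpa using hx
      exact .inl rfl
    · exact .inr (tapeSymbol_of_eq_append_cons (u := u') (r := zeros a ++ true :: r) (by simp [hw])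
        (by simpa using hx))
  have e1 : Reaches w K 1 ⟨check, y + 1 + a, 0⟩ ⟨load, y + a, 0⟩ := by
    refine .cons h1 rfl (by simp) _ (fun b => rfl) ?_
    have : y + 1 + a - 1 = y + a := by omega
    simpa [Move.onHead, Move.onCounter, this] using Reaches.refl _ _
  have e2 := reaches_load (K := K) (v := 0) hz (by simpa using hK)
  have e3 : Reaches w K 1 ⟨load, y, 0 + 2 * a⟩ ⟨skip, y + 1, 2 * a⟩ := by
    rw [zero_add]
    rcases hy with h | h <;>
      exact .cons h rfl (by omega) (skip, .right, .stay) (fun b => rfl) (.refl _ _)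
  have e4 : Reaches w K a ⟨skip, y + 1, 2 * a⟩ ⟨skip, y + 1 + a, 2 * a⟩ :=
    reaches_right rfl (fun _ _ => rfl) hz (by omega)
  have e5 : Reaches w K 1 ⟨skip, y + 1 + a, 2 * a⟩ ⟨sep, y + 1 + a + 1, 2 * a⟩ :=
    .cons h1 rfl (by omega) _ (fun b => rfl) (.refl _ _)
  exact (((e1.trans e2).trans e3).trans (e4.trans e5)).mono (by omega)

/-- Induction on the rest of the word. A round over a block of length `a` takes at most `5 * a + 5`
steps: `5 * a` is in the budget, and each separator has a letter that pays for the other 5. Twice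
the length of a block is the largest counter value, whence the bound `2 * w.length`. -/
theorem reaches_check (hw : w = u ++ (zeros a ++ r)) (hu : u = [] ∨ ∃ u', u = u' ++ [true])
    (hx : x = u.length + a + 1) (ha : 1 ≤ a) (hK : 2 * w.length ≤ K) :
    (∃ ss, r = tailWord a ss) ∧
        Reaches w K (5 * r.length + 5 * a + 10) ⟨check, x, 0⟩ ⟨rewind, w.length + 1, 0⟩ ∨
      (∀ ss, r ≠ tailWord a ss) ∧ Fails w K (5 * r.length + 5 * a + 10) ⟨check, x, 0⟩ := by
  induction hn : r.length using Nat.strong_induction_on generalizing u a r x with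
  | _ n ih =>
  subst hn
  have hlen : w.length = u.length + a + r.length := by simp [hw, add_assoc]
  have hw' : w = (u ++ zeros a) ++ r := by simp [hw]
  have hx' : x = (u ++ zeros a).length + 1 := by simp [hx]
  rcases r with _ | ⟨_ | _, r⟩
  · refine .inl ⟨⟨[], rfl⟩, ?_⟩
    have : x = w.length + 1 := by simp [hx', hw']
    rw [← this]
    exact (Reaches.cons (t := 0) (tapeSymbol_length_add_one this) rfl (by simp)
      (rewind, .stay, .stay) (fun b => rfl) (.refl _ _)).mono (by omega)
  · exact .inr ⟨fun ss => (tailWord_ne_false_cons a ss r).symm,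
      (fails_of_act (tapeSymbol_of_eq_append_cons hw' hx') rfl (by simp) (fun b => rfl)).mono
        (by omega)⟩
  · have h1 := reaches_load_skip (K := K) hw hu rfl ha (by omega)
    rw [show u.length + 1 + a = x by omega] at h1
    simp only [List.length_cons] at hlen ⊢
    -- The next block must have length `2 * a ≥ 2`, so it begins with 0, and the letter after the
    -- first 1 decides between the separators. Hence only one way of splitting off a separator can
    -- succeed.
    obtain ⟨s, r₂, hr₂, hs, h2⟩ : ∃ s r₂, true :: r = sepWord s ++ r₂ ∧
        (∀ s' r', true :: r = sepWord s' ++ (zeros (2 * a) ++ r') →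
          s' = s ∧ r₂ = zeros (2 * a) ++ r') ∧
        Reaches w K 1 ⟨sep, x + 1, 2 * a⟩
          ⟨dec, (u ++ zeros a ++ sepWord s).length + 1, (2 * a : ℕ)⟩ := by
      obtain ⟨a, rfl⟩ : ∃ b, a = b + 1 := ⟨a - 1, by omega⟩
      by_cases hr : ∃ r₂, r = true :: r₂
      · obtain ⟨r₂, rfl⟩ := hr
        refine ⟨true, r₂, rfl, ?_, ?_⟩
        · rintro (_ | _) r' h <;> simp_all [sepWord, mul_add, zeros_succ]
        · have := tapeSymbol_of_eq_append_cons (w := w) (u := u ++ zeros (a + 1) ++ [true])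
            (b := true) (r := r₂) (x := x + 1) (by simp [hw]) (by simp; omega)
          refine .cons this rfl (by omega) (dec, .right, .stay) (fun b => rfl) ?_
          rw [show (u ++ zeros (a + 1) ++ sepWord true).length + 1 = x + 1 + 1 by
            simp [sepWord]; omega]
          exact .refl _ _
      · refine ⟨false, r, rfl, ?_, ?_⟩
        · rintro (_ | _) r' h <;> simp_all [sepWord]
        · have : ∀ b, act sep (tapeSymbol w (x + 1)) (decide ((2 * (a + 1 : ℕ) : ℤ) = 0)) b =
              (dec, .stay, .stay) := by
            intro b
            rcases r with _ | ⟨_ | _, r⟩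
            · rw [tapeSymbol_length_add_one (by simp [hw]; omega)]; rfl
            · rw [tapeSymbol_of_eq_append_cons (u := u ++ zeros (a + 1) ++ [true])
                (b := false) (r := r) (by simp [hw]) (by simp; omega)]; rfl
            · exact absurd ⟨r, rfl⟩ hr
          refine .cons rfl rfl (by omega) (dec, .stay, .stay) this ?_
          rw [show (u ++ zeros (a + 1) ++ sepWord false).length + 1 = x + 1 by
            simp [sepWord]; omega]
          exact .refl _ _
    have hlen₂ : r.length + 1 = (sepWord s).length + r₂.length := by
      simpa using congrArg List.length hr₂
    have hw₂ : w = (u ++ zeros a ++ sepWord s) ++ r₂ := by simp [hw, hr₂]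
    have hs₁ : 1 ≤ (sepWord s).length := by cases s <;> simp [sepWord]
    have h12 := h1.trans h2
    rcases reaches_dec (K := K) hw₂ rfl (n := 2 * a) (by omega) with ⟨r', rfl, h3⟩ | ⟨hr', h3⟩
    · simp only [List.length_append, length_zeros] at hlen₂
      have hu' : ∃ u', u ++ zeros a ++ sepWord s = u' ++ [true] := by
        cases s
        · exact ⟨u ++ zeros a, rfl⟩
        · exact ⟨u ++ zeros a ++ [true], by simp [sepWord]⟩
      rcases ih r'.length (by rw [List.length_cons]; omega) hw₂ (.inr hu') (add_right_comm _ _ _) (by omega) rfl with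
        ⟨⟨ss, rfl⟩, h4⟩ | ⟨hr', h4⟩
      · exact .inl ⟨⟨s :: ss, hr₂⟩, ((h12.trans h3).trans h4).mono (by omega)⟩
      · refine .inr ⟨fun ss => ?_, ((h12.trans h3).fails h4).mono (by omega)⟩
        rcases ss with _ | ⟨s', ss⟩
        · simp [tailWord]
        · intro h
          exact hr' ss (List.append_cancel_left (hs _ _ h).2)
    · refine .inr ⟨fun ss => ?_, (h12.fails h3).mono (by omega)⟩
      rcases ss with _ | ⟨s', ss⟩
      · simp [tailWord]
      · intro h
        exact hr' _ (hs _ _ h).2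

end DimaState

/-! ### The sequence of separators -/

/-- One step of the scan over the separators, with the counter. -/
def scanStep (c : SepState × ℤ) (s : Bool) : SepState × ℤ :=
  ((sepStep c.1 s).1, (sepStep c.1 s).2.onCounter c.2)

/-- The separators of the `k`-th word of `DIMA`; `true` stands for `11`. -/
def dimaSeps (k : ℕ) : List Bool :=
  List.replicate (3 * k + 1) false ++ true :: true :: List.replicate (3 * k - 3) false

theorem foldl_scanStep_dead (v : ℤ) (ss : List Bool) :
    ss.foldl scanStep (.dead, v) = (.dead, v) := by
  induction ss with
  | nil => rfl
  | cons s ss ih => rw [List.foldl_cons]; exact ih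

theorem foldl_scanStep_post (v : ℤ) (ss : List Bool) :
    ss.foldl scanStep (.post, v) = (.post, 0) ↔ ∃ b : ℕ, ss = List.replicate b false ∧ v = b := by
  induction ss generalizing v with
  | nil => simp
  | cons s ss ih =>
    rw [List.foldl_cons]
    rcases s with _ | _
    · refine (ih (v - 1)).trans ⟨?_, ?_⟩
      · rintro ⟨b, rfl, hb⟩
        exact ⟨b + 1, rfl, by push_cast; omega⟩
      · rintro ⟨_ | b, hs, hb⟩
        · simp at hs
        · exact ⟨b, List.cons_injective hs, by push_cast at hb; omega⟩
    · rw [show scanStep (.post, v) true = (.dead, v) from rfl, foldl_scanStep_dead]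
      simp [List.eq_replicate_iff]

theorem foldl_scanStep_mid (v : ℤ) (ss : List Bool) :
    ss.foldl scanStep (.mid, v) = (.post, 0) ↔
      ∃ b : ℕ, ss = true :: List.replicate b false ∧ v = b := by
  rcases ss with _ | ⟨_ | _, ss⟩
  · simp
  · rw [List.foldl_cons, show scanStep (.mid, v) false = (.dead, v) from rfl, foldl_scanStep_dead]
    simp
  · exact (foldl_scanStep_post v ss).trans (by simp)

/-- The state records the number of single separators modulo 3, while the counter records the number
itself, to be cancelled after the marked block. -/
theorem foldl_scanStep_pre (j : Fin 3) (v : ℤ) (ss : List Bool) :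
    ss.foldl scanStep (.pre j, v) = (.post, 0) ↔
      ∃ m b : ℕ, ss = List.replicate m false ++ true :: true :: List.replicate b false ∧
        3 ∣ j + m ∧ v + m = b := by
  induction ss generalizing j v with
  | nil => simp
  | cons s ss ih =>
    rw [List.foldl_cons]
    rcases s with _ | _
    · have h : scanStep (.pre j, v) false = (.pre (j + 1), v + 1) := by fin_cases j <;> rfl
      have hj : ∀ m : ℕ, 3 ∣ ((j + 1 : Fin 3) : ℕ) + m ↔ 3 ∣ (j : ℕ) + (m + 1) := by
        intro m; fin_cases j <;> simp <;> omega
      rw [h, ih]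
      constructor
      · rintro ⟨m, b, rfl, h1, h2⟩
        exact ⟨m + 1, b, rfl, (hj m).1 h1, by push_cast; omega⟩
      · rintro ⟨_ | m, b, h1, h2, h3⟩
        · simp at h1
        · exact ⟨m, b, List.cons_injective h1, (hj m).2 h2, by push_cast at h3; omega⟩
    · have hs : ∀ m (r : List Bool), true :: ss = List.replicate m false ++ true :: r ↔
          m = 0 ∧ ss = r := by
        rintro (_ | m) r <;> simp [List.replicate_succ]
      simp only [hs]
      by_cases hj : j = 0
      · subst hj
        refine (foldl_scanStep_mid v ss).trans ?_
        simp
      · have h : scanStep (.pre j, v) true = (.dead, v) := by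
          fin_cases j
          · exact absurd rfl hj
          · rfl
          · rfl
        rw [h, foldl_scanStep_dead]
        simp only [Prod.mk.injEq, reduceCtorEq, false_and, false_iff, not_exists]
        rintro m b ⟨⟨rfl, -⟩, h, -⟩
        exact hj (Fin.ext (by simp; omega))

/-- Since `3 * k + 1 = 4 + (3 * k - 3)`, once four separators are skipped the numbers of single
separators on both sides of the marked block must be equal and divisible by 3. The four skipped ones
force `0 < k`. -/
theorem foldl_scanStep_init (ss : List Bool) :
    ss.foldl scanStep (.init 0, 0) = (.post, 0) ↔ ∃ k, 0 < k ∧ ss = dimaSeps k := by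
  have h : (∃ k, 0 < k ∧ ss = dimaSeps k) ↔ ∃ r, ss = List.replicate 4 false ++ r ∧
      r.foldl scanStep (.pre 0, 0) = (.post, 0) := by
    simp only [foldl_scanStep_pre]
    constructor
    · rintro ⟨k, hk, rfl⟩
      refine ⟨_, ?_, 3 * k - 3, 3 * k - 3, rfl, ?_, by simp⟩
      · rw [← List.append_assoc, List.replicate_append_replicate, dimaSeps]
        congr 2; omega
      · simp
    · rintro ⟨_, rfl, m, b, rfl, h1, h2⟩
      have h3 : m = b := by omega
      subst h3
      obtain ⟨t, rfl⟩ : 3 ∣ m := by simpa using h1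
      refine ⟨t + 1, by omega, ?_⟩
      rw [← List.append_assoc, List.replicate_append_replicate, dimaSeps]
      congr 2; omega
  rw [h]
  have hd : ∀ v r, (r : List Bool).foldl scanStep (.dead, v) ≠ (.post, 0) := by
    intro v r; rw [foldl_scanStep_dead]; simp
  rcases ss with _ | ⟨_ | _, _ | ⟨_ | _, _ | ⟨_ | _, _ | ⟨_ | _, ss⟩⟩⟩⟩ <;>
    simp [List.replicate_succ, scanStep, sepStep, Move.onCounter, hd]

theorem flatMap_range_eq_tailWord (g : ℕ → Bool) (n : ℕ) :
    (List.range n).flatMap (fun i => zeros (2 ^ i) ++ sepWord (g i)) ++ zeros (2 ^ n) =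
      zeros 1 ++ tailWord 1 ((List.range n).map g) := by
  induction n with
  | zero => simp [tailWord]
  | succ n ih =>
    rw [List.range_succ, List.map_append, tailWord_append, ← List.append_assoc, ← ih]
    simp [tailWord, pow_succ, mul_comm]

theorem dimaWord_eq (k : ℕ) (hk : 0 < k) : dimaWord k = zeros 1 ++ tailWord 1 (dimaSeps k) := by
  have hs : dimaSeps k = (List.range (6 * k)).map
      (fun i => decide (i = 3 * k + 1 ∨ i = 3 * k + 2)) := by
    apply List.ext_getElem
    · simp [dimaSeps]; omega
    · intro i h1 h2
      simp only [dimaSeps, List.getElem_append, List.getElem_cons, List.getElem_replicate,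
        List.length_replicate, List.getElem_map, List.getElem_range]
      split_ifs <;> simp <;> omega
  rw [hs, ← flatMap_range_eq_tailWord, dimaWord]
  congr 3
  funext i
  simp [dimaSep, sepWord]

/-- Splits membership into the two conditions that the two passes check independently: doubling
blocks, and a correct sequence of separators. -/
theorem mem_DIMA_iff (w : List Bool) :
    w ∈ DIMA ↔ ∃ ss, w = zeros 1 ++ tailWord 1 ss ∧
      ss.foldl scanStep (.init 0, 0) = (.post, 0) := by
  simp only [foldl_scanStep_init]
  constructor
  · rintro ⟨k, hk, rfl⟩
    exact ⟨_, dimaWord_eq k hk, k, hk, rfl⟩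
  · rintro ⟨_, rfl, k, hk, rfl⟩
    exact ⟨k, hk, (dimaWord_eq k hk).symm⟩

/-! ### The scan over the separators and the decision of `DIMA` -/

namespace DimaState

variable {w u r : List Bool} {K a x t n : ℕ} {v : ℤ} {s : DimaState} {c c' : Config DimaState}

theorem reaches_rewind : Reaches w K (x + 1) ⟨rewind, x, 0⟩ ⟨scan (.init 0), 1, 0⟩ := by
  induction x with
  | zero => exact .cons (σ := .leftEnd) rfl rfl (by simp) _ (fun b => rfl) (.refl _ _)
  | succ x ih =>
    refine .cons rfl rfl (by simp) (rewind, .left, .stay) (fun b => ?_) ih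
    have := tapeSymbol_ne_leftEnd w x
    revert this
    cases tapeSymbol w (x + 1) <;> simp [act]

theorem natAbs_onCounter_le (m : Move) (v : ℤ) : (m.onCounter v).natAbs ≤ v.natAbs + 1 := by
  cases m <;> simp [Move.onCounter] <;> omega

/-- Blocks are nonempty, so the letter after a 1 tells `1` from `11`. After a single 1 the head
waits on the next 0, which makes two steps for that separator's only cell; all other cells take one.
Each separator changes the counter by at most 1. -/
theorem reaches_scan (q : SepState) (ss : List Bool) (hw : w = u ++ (zeros a ++ tailWord a ss))
    (hx : x = u.length + 1) (ha : 1 ≤ a) (hK : v.natAbs + ss.length ≤ K) :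
    Reaches w K (2 * (w.length + 1 - x)) ⟨scan q, x, v⟩
        ⟨scan (ss.foldl scanStep (q, v)).1, w.length + 1, (ss.foldl scanStep (q, v)).2⟩ ∧
      (ss.foldl scanStep (q, v)).2.natAbs ≤ K := by
  induction ss generalizing u a x v q with
  | nil =>
    refine ⟨?_, hK⟩
    have h1 := reaches_right (s := scan q) (K := K) (v := v) rfl (fun _ _ => rfl)
      (tapeSymbol_of_eq_append_zeros hw hx) (by omega)
    have hl : x + a = w.length + 1 := by simp [hw, hx, tailWord]; omega
    rw [hl] at h1
    exact h1.mono (by omega)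
  | cons s ss ih =>
    have h1 := reaches_right (s := scan q) (K := K) (v := v) rfl (fun _ _ => rfl)
      (tapeSymbol_of_eq_append_zeros hw hx) (by omega)
    obtain ⟨r, hr⟩ : ∃ r, sepWord s = true :: r := by cases s <;> exact ⟨_, rfl⟩
    have h2 : tapeSymbol w (x + a) = .letter true :=
      tapeSymbol_of_eq_append_cons (u := u ++ zeros a)
        (r := r ++ (zeros (2 * a) ++ tailWord (2 * a) ss)) (by simp [hw, tailWord, hr])
        (by simp [hx]; omega)
    have hv := natAbs_onCounter_le (sepStep q s).2 v
    rw [List.length_cons] at hK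
    have hw' : w = (u ++ zeros a ++ sepWord s) ++ (zeros (2 * a) ++ tailWord (2 * a) ss) := by
      simp [hw, tailWord]
    have hl := congrArg List.length hw'
    simp only [List.length_append, length_zeros] at hl
    have h3 : Reaches w K 2 ⟨scan q, x + a, v⟩ ⟨scan (sepStep q s).1,
        (u ++ zeros a ++ sepWord s).length + 1, (sepStep q s).2.onCounter v⟩ := by
      refine .cons h2 rfl (by omega) (scanSep q, .right, .stay) (fun b => rfl) ?_
      rcases s with _ | _
      · obtain ⟨b, rfl⟩ : ∃ b, a = b + 1 := ⟨a - 1, by omega⟩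
        have h4 : tapeSymbol w (x + (b + 1) + 1) = .letter false :=
          tapeSymbol_of_eq_append_zeros hw'
            (by simp [sepWord, hx]; omega) 0 (by omega)
        refine .cons h4 rfl (by simp [Move.onCounter]; omega) _ (fun b => rfl) ?_
        rw [show (u ++ zeros (b + 1) ++ sepWord false).length + 1 = x + (b + 1) + 1 by
          simp [sepWord, hx]; omega]
        exact .refl _ _
      · have h4 : tapeSymbol w (x + a + 1) = .letter true :=
          tapeSymbol_of_eq_append_cons (u := u ++ zeros a ++ [true])
            (r := zeros (2 * a) ++ tailWord (2 * a) ss) (by simp [hw', sepWord])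
            (by simp [hx]; omega)
        refine .cons h4 rfl (by simp [Move.onCounter]; omega) _ (fun b => rfl) ?_
        rw [show (u ++ zeros a ++ sepWord true).length + 1 = x + a + 1 + 1 by
          simp [sepWord, hx]; omega]
        exact .refl _ _
    obtain ⟨h5, h6⟩ := ih (sepStep q s).1 hw' rfl (by omega) (v := (sepStep q s).2.onCounter v)
      (by omega)
    refine ⟨((h1.trans h3).trans h5).mono ?_, h6⟩
    simp only [List.length_append, length_zeros]
    have : 1 ≤ (sepWord s).length := by simp [hr]
    omega

/-- The deterministic part decides `DIMA`. -/
theorem reaches_verified_or_fails (hK : 2 * w.length ≤ K) :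
    w ∈ DIMA ∧ Reaches w K (8 * w.length + 25) ⟨start, 0, 0⟩ ⟨verified, w.length + 1, 0⟩ ∨
      w ∉ DIMA ∧ Fails w K (8 * w.length + 25) ⟨start, 0, 0⟩ := by
  rw [mem_DIMA_iff]
  have e1 : Reaches w K 1 ⟨start, 0, 0⟩ ⟨first, 1, 0⟩ :=
    .cons (σ := .leftEnd) rfl rfl (by simp) _ (fun b => rfl) (.refl _ _)
  by_cases h : ∃ r, w = false :: r
  · obtain ⟨r, rfl⟩ := h
    have e2 : Reaches (false :: r) K 1 ⟨first, 1, 0⟩ ⟨check, 2, 0⟩ :=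
      .cons (σ := .letter false) rfl rfl (by simp) _ (fun b => rfl) (.refl _ _)
    have e12 := e1.trans e2
    have hscan : ∀ ss, false :: r = zeros 1 ++ tailWord 1 ss →
        Reaches (false :: r) K (2 * (r.length + 1)) ⟨scan (.init 0), 1, 0⟩
          ⟨scan (ss.foldl scanStep (.init 0, 0)).1, (false :: r).length + 1,
            (ss.foldl scanStep (.init 0, 0)).2⟩ ∧
          (ss.foldl scanStep (.init 0, 0)).2.natAbs ≤ K := by
      intro ss h
      have hss := length_le_length_tailWord 1 ss
      have hr : r = tailWord 1 ss := List.cons_injective h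
      subst hr
      exact reaches_scan (u := []) (a := 1) (.init 0) ss h rfl le_rfl (by
          rw [List.length_cons] at hK; simp only [Int.natAbs_zero]; omega)
    rcases reaches_check (w := false :: r) (u := []) (a := 1) rfl (.inl rfl) rfl le_rfl hK with
      ⟨⟨ss, hss⟩, h1⟩ | ⟨hr, h1⟩
    · have h2 := (e12.trans h1).trans reaches_rewind
      by_cases hD : ∃ ss, false :: r = zeros 1 ++ tailWord 1 ss ∧
          ss.foldl scanStep (.init 0, 0) = (.post, 0)
      · refine .inl ⟨hD, ?_⟩
        obtain ⟨ss, h, hp⟩ := hD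
        have h23 := h2.trans (hscan ss h).1
        rw [hp] at h23
        refine (h23.trans (t' := 1) ?_).mono (by rw [List.length_cons]; omega)
        exact .cons (tapeSymbol_length_add_one rfl) rfl (by simp) (verified, .stay, .stay)
          (fun b => rfl) (.refl _ _)
      · have h : false :: r = zeros 1 ++ tailWord 1 ss := by rw [← hss]; rfl
        obtain ⟨h3, h4⟩ := hscan ss h
        refine .inr ⟨hD, ((h2.trans h3).fails (fails_of_act (tapeSymbol_length_add_one rfl) rfl h4
          fun b => ?_)).mono (by rw [List.length_cons]; omega)⟩
        have hp : ss.foldl scanStep (.init 0, 0) ≠ (.post, 0) := fun hp => hD ⟨ss, h, hp⟩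
        generalize ss.foldl scanStep (.init 0, 0) = d at hp
        rcases d with ⟨q, v⟩
        by_cases hq : q = .post
        · have : decide (v = 0) = false := by simp_all
          simp [act, this]
        · simp [act, hq]
    · refine .inr ⟨?_, (e12.fails h1).mono (by rw [List.length_cons]; omega)⟩
      rintro ⟨ss, h2, -⟩
      exact hr ss (List.cons_injective h2)
  · refine .inr ⟨?_, (e1.fails (t' := 1) ?_).mono (by omega)⟩
    · rintro ⟨ss, rfl, -⟩
      exact h ⟨_, rfl⟩
    · rcases w with _ | ⟨_ | _, r⟩
      · exact fails_of_act (σ := .rightEnd) rfl rfl (by simp) (fun b => rfl)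
      · exact absurd ⟨r, rfl⟩ h
      · exact fails_of_act (σ := .letter true) rfl rfl (by simp) (fun b => rfl)

end DimaState

/-- The expectation of `f (h + H)`, where `H` is the number of heads in `n` tosses of a coin that
shows heads with probability `p`. -/
def tossExp (p : ℝ) : ℕ → (ℕ → ℝ) → ℕ → ℝ
  | 0, f, h => f h
  | n + 1, f, h => p * tossExp p n f (h + 1) + (1 - p) * tossExp p n f h

/-- The parity of the number of complete blocks of length `M` in `h`. -/
def blockParity (M h : ℕ) : ℝ := if (h / M).bodd then 1 else 0

/-- The blocks between the marked block of the `k`-th word of `DIMA` and the last block. -/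
def middleBlocks (k n : ℕ) : List Bool :=
  (List.range n).flatMap fun i => zeros (2 ^ (3 * k + 3 + i)) ++ [true]

theorem middleBlocks_succ (k n : ℕ) : middleBlocks k (n + 1) =
    middleBlocks k n ++ (zeros (2 ^ (3 * k + 3 + n)) ++ [true]) := by
  simp [middleBlocks, List.range_succ]

/-- The cell before the last block holds a 1, which ends the tosses. If `k = 1` there are no middle
blocks, and this is the second letter of `11`. -/
theorem exists_true_cons_middleBlocks (k n : ℕ) : ∃ y, true :: middleBlocks k n = y ++ [true] := by
  rcases n with _ | n
  · exact ⟨[], rfl⟩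
  · exact ⟨true :: (middleBlocks k n ++ zeros (2 ^ (3 * k + 3 + n))), by simp [middleBlocks_succ]⟩

theorem dimaWord_eq_append {k : ℕ} (hk : 0 < k) :
    ∃ u, dimaWord k = u ++ true :: (zeros (2 ^ (3 * k + 2)) ++ true :: true ::
      (middleBlocks k (3 * k - 3) ++ zeros (64 ^ k))) := by
  -- The prefix keeps the first 1 of the left `11`, so the letter next to the marked block is the
  -- second.
  refine ⟨(List.range (3 * k + 1)).flatMap (fun i => zeros (2 ^ i) ++ dimaSep k i) ++
    (zeros (2 ^ (3 * k + 1)) ++ [true]), ?_⟩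
  have h1 : 6 * k = (3 * k + 3) + (3 * k - 3) := by omega
  have h2 : 2 ^ (6 * k) = 64 ^ k := by rw [pow_mul]; norm_num
  have h3 : (List.range (3 * k - 3)).flatMap
      (fun i => zeros (2 ^ (3 * k + 3 + i)) ++ dimaSep k (3 * k + 3 + i)) =
      middleBlocks k (3 * k - 3) := by
    rw [middleBlocks]
    congr 1
    funext i
    rw [dimaSep, if_neg (by omega)]
  rw [dimaWord, h2, h1, List.range_add, List.flatMap_append, List.flatMap_map, h3,
    List.range_succ, List.range_succ]
  simp [dimaSep]

/-! ### Tossing coins and measuring the number of heads by the marked block -/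

namespace DimaState

variable {A : DimaState} {w u r : List Bool} {K a x t n M : ℕ} {v : ℤ} {s : DimaState}
  {c c' : Config DimaState} {p : ℝ}

/-- Because blocks are nonempty, a single separator has a 0 on its left, so a second 1 there can
only belong to the separator `11` after the marked block. -/
theorem reaches_find (k n : ℕ) (hw : w = u ++ true :: true :: (middleBlocks k n ++ r))
    (hx : x = u.length + 2 + (middleBlocks k n).length) (hv : v.natAbs ≤ K) :
    Reaches w K (2 * (middleBlocks k n).length + 2) ⟨find, x, v⟩ ⟨count false, u.length, v⟩ := by
  induction n generalizing x r with
  | zero =>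
    obtain rfl : x = u.length + 2 := hx
    refine .cons (tapeSymbol_of_eq_append_cons (u := u ++ [true]) (r := r) (b := true)
      (by simp [hw, middleBlocks]) (by simp)) rfl hv (find', .left, .stay) (fun b => rfl) ?_
    exact .cons (tapeSymbol_of_eq_append_cons hw rfl) rfl hv (count false, .left, .stay)
      (fun b => rfl) (.refl _ _)
  | succ n ih =>
    have hM : 1 ≤ 2 ^ (3 * k + 3 + n) := Nat.one_le_two_pow
    rw [middleBlocks_succ] at hw hx ⊢
    generalize 2 ^ (3 * k + 3 + n) = M at *
    obtain ⟨y, hy⟩ : ∃ y, y = u.length + 2 + (middleBlocks k n).length := ⟨_, rfl⟩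
    have hz := tapeSymbol_of_eq_append_zeros (w := w) (x := y + 1) (a := M)
      (u := u ++ true :: true :: middleBlocks k n) (r := true :: r) (by simp [hw])
      (by simp [hy]; omega)
    have h1 : tapeSymbol w (y + M + 1) = .letter true :=
      tapeSymbol_of_eq_append_cons (u := u ++ true :: true :: (middleBlocks k n ++ zeros M))
        (r := r) (by simp [hw]) (by simp [hy]; omega)
    have h2 : tapeSymbol w (y + M) = .letter false := by
      rw [← hz (M - 1) (by omega)]; congr 1; omega
    have h3 := ih (r := zeros M ++ true :: r) (by simp [hw]) hy
    have h4 : Reaches w K M ⟨find, y + M, v⟩ ⟨find, y, v⟩ :=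
      reaches_left rfl (fun _ _ => rfl) hz hv
    have h5 : Reaches w K 2 ⟨find, y + M + 1, v⟩ ⟨find, y + M, v⟩ :=
      .cons h1 rfl hv (find', .left, .stay) (fun b => rfl)
        (.cons h2 rfl hv (find, .stay, .stay) (fun b => rfl) (.refl _ _))
    rw [show x = y + M + 1 by simp [hx, hy]; omega]
    exact ((h5.trans h4).trans h3).mono (by simp; omega)

theorem reaches_count (odd : Bool) {h : ℕ}
    (hz : ∀ i < a, tapeSymbol w (x + 1 + i) = .letter false) (hK : h + a ≤ K) :
    Reaches w K a ⟨count odd, x + a, (h + a : ℕ)⟩ ⟨count odd, x, h⟩ := by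
  induction a with
  | zero => exact .refl _ _
  | succ a ih =>
    have hd : decide (((h + (a + 1) : ℕ) : ℤ) = 0) = false := by simp; omega
    refine .cons (σ := .letter false) ?_ rfl (by omega) (count odd, .left, .left)
      (fun b => by rw [hd]; rfl) ?_
    · rw [← hz a (by omega)]; congr 1; omega
    · have e : Move.left.onCounter ((h + (a + 1) : ℕ) : ℤ) = (h + a : ℕ) := by
        simp [Move.onCounter]; omega
      have := ih (fun i hi => hz i (by omega)) (by omega)
      rwa [← e] at this

/-- Each complete sweep subtracts `M` and flips the parity; if fewer than `M` heads remain, the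
counter vanishes on a cell of the block. If exactly `M` remain, the left separator is still reached
and the sweep counts. A complete round takes `2 * M + 2 ≤ 4 * M` steps. -/
theorem run_count (hw : w = u ++ true :: (zeros M ++ true :: r)) (hM : 1 ≤ M) (odd : Bool) (h : ℕ)
    (hK : h ≤ K) : Run acc w p K (4 * h + 2) ⟨count odd, u.length + 1 + M, h⟩
      (if xor odd (h / M).bodd then 1 else 0) := by
  induction h using Nat.strong_induction_on generalizing odd with
  | _ h ih =>
  have hz := tapeSymbol_of_eq_append_zeros (w := w) (x := u.length + 1 + 1) (a := M)
    (u := u ++ [true]) (r := true :: r) (by simp [hw]) (by simp)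
  rcases Nat.lt_or_ge h M with hlt | hge
  · obtain ⟨i, rfl⟩ : ∃ i, M = i + 1 + h := ⟨M - h - 1, by omega⟩
    have h1 := reaches_count (w := w) (K := K) (x := u.length + 1 + (i + 1)) (a := h) odd (h := 0)
      (fun j hj => by rw [← hz (i + 1 + j) (by omega)]; congr 1; omega) (by omega)
    have h2 : tapeSymbol w (u.length + 1 + (i + 1)) = .letter false := by
      rw [← hz i (by omega)]; congr 1; omega
    rw [Nat.div_eq_of_lt hlt]
    have h3 : Run acc w p K 1 ⟨count odd, u.length + 1 + (i + 1), (0 : ℕ)⟩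
        (if xor odd (Nat.bodd 0) then 1 else 0) := by
      refine .cons h2 (by simp) (by simp) (by simp) _ (fun b => rfl) ?_
      cases odd
      · exact .rej _ rfl (by simp [Move.onCounter])
      · exact .acc _ rfl (by simp [Move.onCounter])
    have := (h1.run rfl h3).mono (show h + 1 ≤ 4 * h + 2 by omega)
    rwa [zero_add, add_assoc] at this
  · obtain ⟨h, rfl⟩ : ∃ i, h = i + M := ⟨h - M, by omega⟩
    have h1 := reaches_count (w := w) (K := K) odd (h := h) hz hK
    have hl : tapeSymbol w (u.length + 1) = .letter true := tapeSymbol_of_eq_append_cons hw rfl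
    have hr : tapeSymbol w (u.length + 1 + 1 + M) = .letter true :=
      tapeSymbol_of_eq_append_cons (u := u ++ true :: zeros M) (r := r) (by simp [hw])
        (by simp; omega)
    have h2 : Reaches w K 1 ⟨count odd, u.length + 1, h⟩ ⟨back (!odd), u.length + 1 + 1, h⟩ :=
      .cons hl rfl (by omega) _ (fun b => rfl) (.refl _ _)
    have h3 : Reaches w K M ⟨back (!odd), u.length + 1 + 1, h⟩
        ⟨back (!odd), u.length + 1 + 1 + M, h⟩ :=
      reaches_right rfl (fun _ _ => rfl) hz (by omega)
    have h4 : Reaches w K 1 ⟨back (!odd), u.length + 1 + 1 + M, h⟩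
        ⟨count (!odd), u.length + 1 + M, h⟩ := by
      refine .cons hr rfl (by omega) (count (!odd), .left, .stay) (fun b => rfl) ?_
      rw [show u.length + 1 + 1 + M = u.length + 1 + M + 1 by omega]
      exact .refl _ _
    have h5 := ((h1.trans h2).trans (h3.trans h4)).run rfl (ih h (by omega) (!odd) (by omega))
    have h6 : xor (!odd) (h / M).bodd = xor odd ((h + M) / M).bodd := by
      rw [Nat.add_div_right _ (by omega), Nat.bodd_succ]
      cases odd <;> cases (h / M).bodd <;> rfl
    rw [h6] at h5
    exact h5.mono (by omega)

/-- One branching step of `Run` is one unfolding of `tossExp`, so the value after all tosses is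
averaged over the number of heads. -/
theorem run_toss {f : ℕ → ℝ} {h : ℕ} (hz : ∀ i < a, tapeSymbol w (x + 1 + i) = .letter false)
    (hK : h + a ≤ K) (hf : ∀ h' ≤ h + a, Run acc w p K t ⟨toss, x, h'⟩ (f h')) :
    Run acc w p K (t + a) ⟨toss, x + a, h⟩ (tossExp p a f h) := by
  induction a generalizing h with
  | zero => exact hf h le_rfl
  | succ a ih =>
    have hσ : tapeSymbol w (x + (a + 1)) = .letter false := by
      rw [← hz a (by omega)]; congr 1; omega
    refine Run.step (by simp) (by simp) (by simp; omega) ?_ ?_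
    · simp only [next, hσ]
      exact ih (h := h + 1) (fun i hi => hz i (by omega)) (by omega)
        (fun h' hh => hf h' (by omega))
    · simp only [next, hσ]
      exact ih (h := h) (fun i hi => hz i (by omega)) (by omega) (fun h' hh => hf h' (by omega))

theorem run_verified {k : ℕ} (hk : 0 < k) (hw : w = dimaWord k) (hK : w.length ≤ K) :
    Run acc w p K (8 * w.length + 10) ⟨verified, w.length + 1, 0⟩
      (tossExp p (64 ^ k) (blockParity (2 ^ (3 * k + 2))) 0) := by
  obtain ⟨u, hu⟩ := dimaWord_eq_append hk
  rw [← hw] at hu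
  set M := 2 ^ (3 * k + 2)
  set N := 64 ^ k
  set Y := middleBlocks k (3 * k - 3) with hY
  have hM : 1 ≤ M := Nat.one_le_two_pow
  have hl : w.length = u.length + 1 + M + 2 + Y.length + N := by
    simp [hu]; omega
  obtain ⟨x, hx⟩ : ∃ x, x = u.length + 1 + M + 2 + Y.length := ⟨_, rfl⟩
  have hz := tapeSymbol_of_eq_append_zeros (w := w) (x := x + 1) (a := N) (r := [])
    (u := u ++ true :: (zeros M ++ true :: true :: Y)) (by simp [hu]) (by simp [hx]; omega)
  have htrue : tapeSymbol w x = .letter true := by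
    obtain ⟨y, hy⟩ := exists_true_cons_middleBlocks k (3 * k - 3)
    rw [← hY] at hy
    have hl := congrArg List.length hy
    simp only [List.length_cons, List.length_append, List.length_nil] at hl
    refine tapeSymbol_of_eq_append_cons (u := u ++ true :: (zeros M ++ true :: y)) (b := true)
      (r := zeros N) ?_ (by simp; omega)
    rw [hu, show true :: (Y ++ zeros N) = (true :: Y) ++ zeros N from rfl, hy]
    simp
  have h1 : ∀ h' ≤ N, Run acc w p K (7 * w.length + 9) ⟨toss, x, h'⟩ (blockParity M h') := by
    intro h' hh
    have e1 : Reaches w K 1 ⟨toss, x, h'⟩ ⟨find, x, h'⟩ :=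
      .cons htrue rfl (by omega) (find, .stay, .stay) (fun b => rfl) (.refl _ _)
    have e2 := reaches_find (w := w) (K := K) (v := h') (x := x) (u := u ++ true :: zeros M)
      (r := zeros N) k (3 * k - 3) (by rw [← hY]; simp [hu]) (by rw [← hY]; simp [hx]; omega)
      (by omega)
    rw [← hY, show (u ++ true :: zeros M).length = u.length + 1 + M by simp; omega] at e2
    have e3 := (e1.trans e2).run rfl (run_count (K := K) (p := p) hu hM false h' (by omega))
    rw [Bool.false_xor] at e3
    exact e3.mono (by omega)
  have h2 := run_toss (K := K) (h := 0) hz (by omega) (fun h' hh => h1 h' (by omega))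
  refine (Run.cons (tapeSymbol_length_add_one rfl) (by simp) (by simp) (by simp)
    (toss, .left, .stay) (fun b => rfl) (q := tossExp p N (blockParity M) 0)
    (t := 7 * w.length + 9 + N) ?_).mono (by omega)
  rw [show w.length + 1 = x + N + 1 by omega]
  exact h2

end DimaState

/-! ### The number of heads -/

theorem tossExp_mono {p : ℝ} (h0 : 0 ≤ p) (h1 : p ≤ 1) (n : ℕ) {f g : ℕ → ℝ} (hfg : ∀ x, f x ≤ g x)
    (h : ℕ) : tossExp p n f h ≤ tossExp p n g h := by
  induction n generalizing h with
  | zero => exact hfg h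
  | succ n ih =>
    have := sub_nonneg.2 h1
    exact add_le_add (mul_le_mul_of_nonneg_left (ih _) h0) (mul_le_mul_of_nonneg_left (ih _) this)

/-- The mean and the variance of the number of heads. -/
theorem tossExp_quadratic (p : ℝ) (n : ℕ) (α β a : ℝ) (h : ℕ) :
    tossExp p n (fun x => α + β * ((x : ℝ) - a) ^ 2) h =
      α + β * ((h + n * p - a) ^ 2 + n * (p * (1 - p))) := by
  induction n generalizing h with
  | zero => simp [tossExp]
  | succ n ih =>
    rw [tossExp, ih, ih]
    push_cast
    ring

/-- Chebyshev's inequality: `f` dominates the parabola `1 - (x - n * p) ^ 2 / R ^ 2`, whose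
expectation is `1 - p * (1 - p) ≥ 3 / 4` because the variance is `n * p * (1 - p)` and `n = R ^ 2`.
-/
theorem le_tossExp_of_near {p : ℝ} (h0 : 0 ≤ p) (h1 : p ≤ 1) {n : ℕ} {R : ℝ} (hR : 0 < R)
    (hn : (n : ℝ) = R ^ 2) {f : ℕ → ℝ} (hf0 : ∀ x, 0 ≤ f x)
    (hf : ∀ x : ℕ, |(x : ℝ) - n * p| < R → f x = 1) : 3 / 4 ≤ tossExp p n f 0 := by
  have h := tossExp_mono h0 h1 n (f := fun x => 1 + -(R ^ 2)⁻¹ * ((x : ℝ) - n * p) ^ 2) (g := f)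
    (fun x => ?_) 0
  · rw [tossExp_quadratic, hn] at h
    have : (R ^ 2)⁻¹ * R ^ 2 = 1 := inv_mul_cancel₀ (by positivity)
    have h2 : 1 + -(R ^ 2)⁻¹ * ((((0 : ℕ) : ℝ) + R ^ 2 * p - R ^ 2 * p) ^ 2 + R ^ 2 * (p * (1 - p)))
        = 1 - p * (1 - p) := by
      linear_combination (-(p * (1 - p))) * this
    rw [h2] at h
    nlinarith [sq_nonneg (p - 1 / 2)]
  · by_cases hx : |(x : ℝ) - n * p| < R
    · rw [hf x hx]
      have : 0 ≤ (R ^ 2)⁻¹ * ((x : ℝ) - n * p) ^ 2 := by positivity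
      linarith
    · have h3 : R ^ 2 ≤ ((x : ℝ) - n * p) ^ 2 := by
        rw [← sq_abs ((x : ℝ) - n * p)]
        exact pow_le_pow_left₀ hR.le (not_lt.1 hx) 2
      have h4 := mul_le_mul_of_nonneg_left h3 (inv_nonneg.2 (sq_nonneg R))
      rw [inv_mul_cancel₀ (by positivity)] at h4
      linarith [hf0 x]

theorem tossExp_const_sub (p : ℝ) (n : ℕ) (f : ℕ → ℝ) (h : ℕ) :
    tossExp p n (fun x => 1 - f x) h = 1 - tossExp p n f h := by
  induction n generalizing h with
  | zero => rfl
  | succ n ih =>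
    rw [tossExp, tossExp, ih, ih]
    ring

/-- Multiplication by `b ^ (n + 1)` shifts the digit of index `n` to the units place; `t` is the
number formed by the later digits. The closed bound `t ≤ 1` avoids any discussion of repeating
digits. -/
theorem exists_pow_mul_ofDigits {b : ℕ} (d : ℕ → Fin b) (n : ℕ) :
    ∃ (A : ℕ) (t : ℝ), 0 ≤ t ∧ t ≤ 1 ∧
      (b : ℝ) ^ (n + 1) * Real.ofDigits d = b * A + (d n : ℕ) + t := by
  have hb : (b : ℝ) ≠ 0 := Nat.cast_ne_zero.2 (Fin.pos (d 0)).ne'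
  have hsum : ∀ n, ∃ A : ℕ, (b : ℝ) ^ n * ∑ i ∈ Finset.range n, Real.ofDigitsTerm d i = A := by
    intro n
    induction n with
    | zero => exact ⟨0, by simp⟩
    | succ n ih =>
      obtain ⟨A, hA⟩ := ih
      refine ⟨b * A + (d n : ℕ), ?_⟩
      rw [Finset.sum_range_succ, Real.ofDigitsTerm, mul_add]
      push_cast
      rw [← hA]
      field_simp
      ring
  obtain ⟨A, hA⟩ := hsum n
  refine ⟨A, Real.ofDigits fun i => d (i + (n + 1)), Real.ofDigits_nonneg _,
    Real.ofDigits_le_one _, ?_⟩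
  rw [Real.ofDigits_eq_sum_add_ofDigits d (n + 1), Finset.sum_range_succ, Real.ofDigitsTerm, ← hA]
  field_simp
  ring

/-- The digits in base `8` of the probability of heads for the set `I`. In base `2`, the digits
are `x 0 1`, where `x = 1` if the index is in `I`. -/
noncomputable def headDigits (I : Set ℕ+) (n : ℕ) : Fin 8 :=
  open Classical in if n.succPNat ∈ I then 5 else 1

-- With digit `4 * x + 1`, the mean is `8 ^ k` times a number between `8 * A + 4 * x + 1` and `8 * A
-- + 4 * x + 2`. A deviation below `8 ^ k` keeps `h` strictly between `8 ^ k * (8 * A + 4 * x)` and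
-- `8 ^ k * (8 * A + 4 * x + 3)`, where the quotient by `4 * 8 ^ k` is `2 * A + x`.
open Classical in
theorem blockParity_of_near (I : Set ℕ+) (k : ℕ+) (h : ℕ)
    (hh : |(h : ℝ) - (64 ^ (k : ℕ) : ℕ) * Real.ofDigits (headDigits I)| < 8 ^ (k : ℕ)) :
    blockParity (2 ^ (3 * (k : ℕ) + 2)) h = if k ∈ I then 1 else 0 := by
  obtain ⟨n, rfl⟩ : ∃ n : ℕ, k = n.succPNat := ⟨_, (PNat.succPNat_natPred k).symm⟩
  obtain ⟨A, t, ht0, ht1, ht⟩ := exists_pow_mul_ofDigits (headDigits I) n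
  rw [Nat.succPNat_coe, Nat.succ_eq_add_one] at hh ⊢
  have h64 : ((64 ^ (n + 1) : ℕ) : ℝ) = 8 ^ (n + 1) * 8 ^ (n + 1) := by
    rw [← mul_pow]; norm_num
  have hM : 2 ^ (3 * (n + 1) + 2) = 8 ^ (n + 1) * 4 := by
    rw [pow_add, pow_mul]; norm_num
  rw [h64, mul_assoc, show ((8 : ℝ) ^ (n + 1)) = ((8 : ℕ) : ℝ) ^ (n + 1) by norm_num, ht,
    abs_lt] at hh
  have hR : (0 : ℝ) < ((8 : ℕ) : ℝ) ^ (n + 1) := by positivity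
  have key : ∀ x : ℕ, headDigits I n = (4 * x + 1 : ℕ) → h / (8 ^ (n + 1) * 4) = 2 * A + x := by
    intro x hx
    rw [hx] at hh
    obtain ⟨hl, hr⟩ := hh
    apply Nat.div_eq_of_lt_le
    · have : (((2 * A + x) * (8 ^ (n + 1) * 4) : ℕ) : ℝ) ≤ h := by
        push_cast at hl hr hR ⊢
        nlinarith
      exact_mod_cast this
    · have : (h : ℝ) < (((2 * A + x + 1) * (8 ^ (n + 1) * 4) : ℕ) : ℝ) := by
        push_cast at hl hr hR ⊢
        nlinarith
      exact_mod_cast this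
  rw [blockParity, hM]
  by_cases hI : n.succPNat ∈ I
  · rw [key 1 (by simp [headDigits, hI]), if_pos hI]
    simp
  · rw [key 0 (by simp [headDigits, hI]), if_neg hI]
    simp

open Classical in
theorem tossExp_blockParity (I : Set ℕ+) (k : ℕ+) {p : ℝ} (hp : p = Real.ofDigits (headDigits I)) :
    (k ∈ I → 3 / 4 ≤ tossExp p (64 ^ (k : ℕ)) (blockParity (2 ^ (3 * (k : ℕ) + 2))) 0) ∧
      (k ∉ I → tossExp p (64 ^ (k : ℕ)) (blockParity (2 ^ (3 * (k : ℕ) + 2))) 0 ≤ 1 / 4) := by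
  subst hp
  have h0 := Real.ofDigits_nonneg (headDigits I)
  have h1 := Real.ofDigits_le_one (headDigits I)
  have hn : ((64 ^ (k : ℕ) : ℕ) : ℝ) = (8 ^ (k : ℕ)) ^ 2 := by
    rw [← pow_mul, mul_comm, pow_mul]; norm_num
  have hf : ∀ x, 0 ≤ blockParity (2 ^ (3 * (k : ℕ) + 2)) x ∧
      blockParity (2 ^ (3 * (k : ℕ) + 2)) x ≤ 1 := by
    intro x; rw [blockParity]; split_ifs <;> simp
  constructor <;> intro hk
  · refine le_tossExp_of_near h0 h1 (by positivity) hn (fun x => (hf x).1) fun x hx => ?_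
    rw [blockParity_of_near I k x hx, if_pos hk]
  -- The upper bound is the lower bound for the complementary event.
  · have := le_tossExp_of_near h0 h1 (by positivity) hn
      (f := fun x => 1 - blockParity (2 ^ (3 * (k : ℕ) + 2)) x)
      (fun x => sub_nonneg.2 (hf x).2) fun x hx => by
        rw [blockParity_of_near I k x hx, if_neg hk, sub_zero]
    rw [tossExp_const_sub] at this
    linarith

/-! ### The languages -/

/-- The exponent is the length of the longest run of zeros at the end of the word. -/
theorem eq_of_append_true_zeros {u u' : List Bool} {m m' : ℕ}
    (h : u ++ true :: zeros m = u' ++ true :: zeros m') : m = m' := by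
  have key : ∀ (u : List Bool) m,
      ((u ++ true :: zeros m).reverse.takeWhile (fun b => !b)).length = m := by
    intro u m
    have : ∀ r, ((zeros m ++ true :: r).takeWhile (fun b => !b)) = zeros m := by
      intro r
      rw [List.takeWhile_append_of_pos (by simp [zeros])]
      simp
    simp only [List.reverse_append, List.reverse_cons, List.append_assoc]
    rw [show (zeros m).reverse = zeros m from List.reverse_replicate, List.singleton_append, this,
      length_zeros]
  rw [← key u m, h, key]

theorem dimaWord_eq_append_last {k : ℕ} (hk : 0 < k) :
    ∃ u, dimaWord k = u ++ true :: zeros (64 ^ k) := by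
  obtain ⟨u, hu⟩ := dimaWord_eq_append hk
  obtain ⟨y, hy⟩ := exists_true_cons_middleBlocks k (3 * k - 3)
  refine ⟨u ++ true :: (zeros (2 ^ (3 * k + 2)) ++ true :: y), ?_⟩
  rw [hu, show ∀ r, true :: (middleBlocks k (3 * k - 3) ++ r) =
    (true :: middleBlocks k (3 * k - 3)) ++ r from fun _ => rfl, hy]
  simp

theorem dimaWord_mem_DIMAOf (I : Set ℕ+) (k : ℕ+) : dimaWord k ∈ DIMAOf I ↔ k ∈ I := by
  obtain ⟨u, hu⟩ := dimaWord_eq_append_last k.pos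
  constructor
  · rintro ⟨-, u', m, -, hm, j, hj, rfl⟩
    rw [hu] at hm
    have : (k : ℕ) = j := Nat.pow_right_injective (by norm_num) (eq_of_append_true_zeros hm)
    rwa [PNat.eq this]
  · intro hk
    exact ⟨⟨k, k.pos, rfl⟩, u, 64 ^ (k : ℕ), by positivity, hu, k, hk, rfl⟩

theorem DIMAOf_injective : Function.Injective DIMAOf := by
  intro I J h
  ext k
  rw [← dimaWord_mem_DIMAOf, h, dimaWord_mem_DIMAOf]

theorem not_countable_range_DIMAOf : ¬ (Set.range DIMAOf).Countable := by
  intro h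
  have : Countable (Set ℕ+) := by
    rw [← Set.countable_univ_iff]
    exact Set.countable_of_injective_of_countable_image DIMAOf_injective.injOn
      (by rwa [Set.image_univ])
  obtain ⟨g, hg⟩ := exists_injective_nat (Set ℕ+)
  -- Cantor's theorem concerns maps from subsets of a type to that same type, so the numbering is
  -- shifted into `ℕ+`.
  exact Function.cantor_injective (fun s => (g s).succPNat) (Nat.succPNat_injective.comp hg)

/-! ### Correctness and resource bounds of the two automata -/

namespace DimaState

/-- The deterministic part takes at most `8 * w.length + 25` steps and the probabilistic part `8 *
w.length + 10`, together at most `35 * (w.length + 1)`. -/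
theorem exists_run (p : ℝ) (w : List Bool) :
    ∃ q, Run acc w p (2 * w.length) (35 * (w.length + 1)) ⟨start, 0, 0⟩ q ∧
      (w ∉ DIMA ∧ q = 0 ∨ ∃ k : ℕ+, w = dimaWord k ∧
        q = tossExp p (64 ^ (k : ℕ)) (blockParity (2 ^ (3 * (k : ℕ) + 2))) 0) := by
  rcases reaches_verified_or_fails (w := w) le_rfl with ⟨⟨k, hk, hw⟩, h⟩ | ⟨hw, x, v, hv, h⟩
  · exact ⟨_, (h.run rfl (run_verified (p := p) hk hw (by omega))).mono (by omega),
      .inr ⟨⟨k, hk⟩, hw, rfl⟩⟩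
  · exact ⟨0, (h.run rfl (.rej 0 rfl hv)).mono (by omega), .inl ⟨hw, rfl⟩⟩

theorem exists_run_verifier (w : List Bool) :
    ∃ q, Run verified w 0 (2 * w.length) (35 * (w.length + 1)) ⟨start, 0, 0⟩ q ∧
      (w ∉ DIMA ∧ q = 0 ∨ w ∈ DIMA ∧ q = 1) := by
  rcases reaches_verified_or_fails (w := w) le_rfl with ⟨hw, h⟩ | ⟨hw, x, v, hv, h⟩
  · exact ⟨1, (h.run rfl (.acc 0 rfl (by simp))).mono (by omega), .inr ⟨hw, rfl⟩⟩
  · exact ⟨0, (h.run rfl (.rej 0 rfl hv)).mono (by omega), .inl ⟨hw, rfl⟩⟩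

theorem verifier_recognizes : verifier.Recognizes DIMA := by
  intro w
  obtain ⟨q, h, hq⟩ := exists_run_verifier w
  obtain ⟨-, -, h⟩ := verifier_evolve_of_run h
  simp only [TwoDCA.Accepts, TwoDCA.run_eq_evolve]
  rcases hq with ⟨hw, rfl⟩ | ⟨hw, rfl⟩ <;> rcases h with ⟨h1, h⟩ | ⟨h1, h⟩
  · norm_num at h1
  · exact iff_of_false hw (not_exists.2 h)
  · exact iff_of_true hw h
  · norm_num at h1

theorem verifier_linearTime : verifier.LinearTime := by
  refine ⟨35, fun w => ?_⟩
  obtain ⟨q, h, -⟩ := exists_run_verifier w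
  rw [TwoDCA.run_eq_evolve]
  exact (verifier_evolve_of_run h).1

theorem verifier_linearSpace : verifier.LinearSpace := by
  refine ⟨2, fun w t => ?_⟩
  obtain ⟨q, h, -⟩ := exists_run_verifier w
  rw [TwoDCA.run_eq_evolve]
  exact ((verifier_evolve_of_run h).2.1 t).trans (by omega)

variable {p : ℝ} (h0 : 0 ≤ p) (h1 : p ≤ 1)

theorem tosser_linearTime : (tosser p h0 h1).LinearTime := by
  refine ⟨35, fun w => ?_⟩
  obtain ⟨q, h, -⟩ := exists_run p w
  rw [TwoPCA.run_eq_evolve]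
  exact (tosser_evolve_of_run h).1

theorem tosser_linearSpace : (tosser p h0 h1).LinearSpace := by
  refine ⟨2, fun w t c hc => ?_⟩
  obtain ⟨q, h, -⟩ := exists_run p w
  rw [TwoPCA.run_eq_evolve] at hc
  exact ((tosser_evolve_of_run h).2.1 t c hc).trans (by omega)

theorem tosser_acceptProb {w : List Bool} {K t : ℕ} {q : ℝ}
    (h : Run acc w p K t ⟨start, 0, 0⟩ q) :
    (tosser p h0 h1).acceptProb w = ENNReal.ofReal q := by
  obtain ⟨-, -, h2, h3⟩ := tosser_evolve_of_run (h0 := h0) (h1 := h1) h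
  simp only [TwoPCA.acceptProb, TwoPCA.run_eq_evolve]
  exact le_antisymm (iSup_le h2) (h3.symm.le.trans (le_iSup_of_le t le_rfl))

theorem tosser_recognizes (I : Set ℕ+) (hp : p = Real.ofDigits (headDigits I)) :
    (tosser p h0 h1).RecognizesWithError (DIMAOf I) (1 / 4) := by
  have e14 : ENNReal.ofReal (1 / 4) = 1 / 4 := by
    rw [ENNReal.ofReal_div_of_pos (by norm_num)]; simp
  have e34 : 1 - ENNReal.ofReal (1 / 4) = ENNReal.ofReal (3 / 4) := by
    rw [← ENNReal.ofReal_one, ← ENNReal.ofReal_sub _ (by norm_num)]; norm_num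
  rw [← e14]
  constructor <;> intro w hw <;> obtain ⟨q, h, hq⟩ := exists_run p w <;>
    rw [tosser_acceptProb h0 h1 h]
  · rcases hq with ⟨hw', -⟩ | ⟨k, rfl, rfl⟩
    · exact absurd hw.1 hw'
    · rw [e34]
      exact ENNReal.ofReal_le_ofReal
        ((tossExp_blockParity I k hp).1 ((dimaWord_mem_DIMAOf I k).1 hw))
  · rcases hq with ⟨-, rfl⟩ | ⟨k, rfl, rfl⟩
    · simp
    · exact ENNReal.ofReal_le_ofReal
        ((tossExp_blockParity I k hp).2 fun hk => hw ((dimaWord_mem_DIMAOf I k).2 hk))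

end DimaState

open DimaState in
theorem mainTheorem3 :
    (∃ D : TwoDCA Bool, D.Recognizes DIMA ∧ D.LinearTime ∧ D.LinearSpace) ∧
    (∀ I : Set ℕ+, ∃ P : TwoPCA Bool,
      P.RecognizesWithError (DIMAOf I) (1 / 4) ∧ P.LinearTime ∧ P.LinearSpace) ∧
    ¬ (Set.range DIMAOf).Countable ∧
    ¬ LinearTwoPCALanguages.Countable := by
  have h2 : ∀ I : Set ℕ+, ∃ P : TwoPCA Bool,
      P.RecognizesWithError (DIMAOf I) (1 / 4) ∧ P.LinearTime ∧ P.LinearSpace := fun I =>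
    ⟨tosser _ (Real.ofDigits_nonneg (headDigits I)) (Real.ofDigits_le_one _),
      tosser_recognizes _ _ I rfl, tosser_linearTime _ _, tosser_linearSpace _ _⟩
  refine ⟨⟨verifier, verifier_recognizes, verifier_linearTime, verifier_linearSpace⟩, h2,
    not_countable_range_DIMAOf, fun h => not_countable_range_DIMAOf (h.mono ?_)⟩
  rintro _ ⟨I, rfl⟩
  obtain ⟨P, hP, ht, hs⟩ := h2 I
  refine ⟨P, 1 / 4, ?_, hP, ht, hs⟩
  simp only [one_div]
  exact ENNReal.inv_lt_inv.2 (by norm_num)
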